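/- Let $V$ be a real vector space of finite dimension $d$, let $R=\mathbb{R}\llbracket V^\ast\rrbracket$ be the ring of formal power series on $V$, and let $I\subset R$ be its maximal ideal. Let $\mathfrak{k}$ be a compact simple Lie algebra (finite-dimensional, real, simple, with negative definite Killing form), and let $\mathfrak{g}=R\otimes\mathfrak{k}$ with bracket $[f\otimes X,g\otimes Y]=fg\otimes[X,Y]$ and the product topology (convergence of every coefficient). Let $\boldsymbol v$ be a formal vector field on $V$ vanishing at $0$, let $\mathcal{L}_{\boldsymbol v}$ be its Lie derivative on $\mathfrak{g}$ (acting on the factor $R$), and let $\boldsymbol v_{\mathrm l}\in\mathfrak{gl}(V)$ be its linearization at $0$, also regarded as a linear vector field. Let $\sigma\in\mathfrak{g}$, and let $\sigma_0\in\mathfrak{k}\subset\mathfrak{g}$ be its constant term. Assume that $\sigma_0\in\mathfrak{t}$, where $\mathfrak{t}\subseteq\mathfrak{k}$ is a maximal torus, i.e. a maximal abelian subalgebra. Two elements $\sigma,\eta\in\mathfrak{g}$ are called gauge-equivalent (for the fixed $\boldsymbol v$) if there is $\xi\in\mathfrak{g}$ such that $$\eta=e^{\mathrm{ad}_\xi}\sigma+F(\mathrm{ad}_\xi)(-\mathcal{L}_{\boldsymbol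 v}\xi),\qquad F(w)=-\sum_{n\ge 0}\frac{w^n}{(n+1)!}.$$ Let $\boldsymbol\mu=(\mu_1,\dots,\mu_d)$ be the eigenvalues, with multiplicity, on $V_{\mathbb C}$ of the semisimple part of $\boldsymbol v_{\mathrm l}$, and set $\langle\boldsymbol n,\boldsymbol\mu\rangle=\sum_i n_i\mu_i$. The spectrum $\mathrm{Spec}(A)$ of a real operator $A$ is the spectrum of its complexification. Then: 1. If $\langle\boldsymbol n,\boldsymbol\mu\rangle\neq\alpha(\sigma_0)$ for every (nonzero) root $\alpha\in i\mathfrak{t}^\ast$ of $\mathfrak{k}$ and every $\boldsymbol n\in\mathbb{N}_{\ge0}^d$ with $|\boldsymbol n|\ge1$, then $\sigma$ is gauge-equivalent to some $\sigma'\in R\otimes\mathfrak{t}$. 2. If $\boldsymbol v_{\mathrm l}$ is semisimple, then $\sigma$ is gauge-equivalent to some $\nu\in\mathfrak{g}$ satisfying $-\mathcal{L}_{\boldsymbol v_{\mathrm l}}\nu+[\sigma_0,\nu]=0$. 3. Suppose that $\boldsymbol v=\boldsymbol v_{\mathrm l}$ is linear and that, for some $T>0$, $D=-\mathcal{L}_{\boldsymbol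 v}+\mathrm{ad}_\sigma$ is the infinitesimal generator of a continuous action of the circle $\mathbb{R}/T\mathbb{Z}$ on $\mathfrak{g}$ by Lie algebra automorphisms. Then $\sigma$ is gauge-equivalent to $\sigma_0\in\mathfrak{t}$, and $$\mathrm{Spec}(\boldsymbol v_{\mathrm l})\cup\mathrm{Spec}(\mathrm{ad}_{\sigma})\cup\mathrm{Spec}(\mathrm{ad}_{\sigma_0})\subseteq\tfrac{2\pi i}{T}\mathbb{Z},$$ where $\mathrm{ad}_\sigma$ acts on $\mathfrak{g}$ and $\mathrm{ad}_{\sigma_0}$ acts on $\mathfrak{k}$. In particular the spectra lie in $2\pi i\mathbb{Z}$ if $T=1$, and in $i\mathbb{Z}$ if $T=2\pi$. -/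

import Mathlib

open scoped TensorProduct Topology Nat

noncomputable section

namespace JetTwist

/-- The ring `R = ℝ⟦V*⟧` of formal power series on a `d`-dimensional real vector space `V`, written
in the linear coordinates `x₁, …, x_d` of a basis of `V`. -/
abbrev FormalSeries (d : ℕ) : Type := MvPowerSeries (Fin d) ℝ

/-- The Lie algebra `𝔤 = R ⊗ 𝔨`, with `[f ⊗ X, g ⊗ Y] = f g ⊗ [X, Y]` (Mathlib's Lie bracket on an
extension of scalars). -/
abbrev JetAlgebra (d : ℕ) (k : Type*) [LieRing k] [LieAlgebra ℝ k] : Type _ :=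
  FormalSeries d ⊗[ℝ] k

section Structure

variable {d : ℕ} {k : Type*} [LieRing k] [LieAlgebra ℝ k]

/-- The coefficient of `x^n` of a formal power series with coefficients in `𝔨`. -/
def jetCoeff (n : Fin d →₀ ℕ) : JetAlgebra d k →ₗ[ℝ] k :=
  (TensorProduct.lid ℝ k).toLinearMap ∘ₗ LinearMap.rTensor k (MvPowerSeries.coeff n)

/-- Evaluation at the origin `ev₀ : 𝔤 → 𝔨`, i.e. the constant coefficient. -/
def ev0 : JetAlgebra d k →ₗ[ℝ] k := jetCoeff 0

/-- The inclusion of `𝔨` in `𝔤` as the constant power series. -/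
def constJet (d : ℕ) (X : k) : JetAlgebra d k := 1 ⊗ₜ[ℝ] X

/-- The product topology on `𝔤`: convergence of every `𝔨`-valued coefficient, where the
finite-dimensional space `𝔨` has its canonical topology (the coarsest one for which all linear
functionals are continuous). -/
instance jetTopology : TopologicalSpace (JetAlgebra d k) :=
  ⨅ (n : Fin d →₀ ℕ) (l : Module.Dual ℝ k),
    TopologicalSpace.induced (fun ξ : JetAlgebra d k => l (jetCoeff n ξ)) inferInstance

/-- The adjoint operator `ad_ξ = [ξ, ·]` of `𝔤`. -/
abbrev adJet (ξ : JetAlgebra d k) : Module.End ℝ (JetAlgebra d k) :=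
  LieAlgebra.ad ℝ (JetAlgebra d k) ξ

/-- The subspace `R ⊗ 𝔱` of `R ⊗ 𝔨`. -/
def jetSubspace (d : ℕ) (t : LieSubalgebra ℝ k) :
    Submodule (FormalSeries d) (JetAlgebra d k) :=
  t.toSubmodule.baseChange (FormalSeries d)

end Structure

/-! ### Formal vector fields vanishing at the origin -/

/-- A formal vector field `v = ∑ᵢ vᵢ ∂ᵢ` on `V` with `v(0) = 0`, i.e. an element of `I ⊗ V`. -/
structure FormalVectorField (d : ℕ) where
  comp : Fin d → FormalSeries d
  vanishes : ∀ i, MvPowerSeries.constantCoeff (comp i) = 0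

/-- The Lie derivative `L_v f = ∑ᵢ vᵢ ∂ᵢ f` on `R`. -/
def FormalVectorField.lieDerivative {d : ℕ} (v : FormalVectorField d) :
    Derivation ℝ (FormalSeries d) (FormalSeries d) :=
  ∑ i, v.comp i • MvPowerSeries.pderiv ℝ i

/-- The Lie derivative `L_v ⊗ id` on `𝔤 = R ⊗ 𝔨`. -/
def FormalVectorField.lieJet {d : ℕ} (v : FormalVectorField d)
    (k : Type*) [LieRing k] [LieAlgebra ℝ k] : Module.End ℝ (JetAlgebra d k) :=
  LinearMap.rTensor k (v.lieDerivative : FormalSeries d →ₗ[ℝ] FormalSeries d)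

section Linear

variable {d : ℕ} {V : Type*} [AddCommGroup V] [Module ℝ V]

/-- The linearization `v_l ∈ 𝔤𝔩(V)` of `v` at the origin, with matrix `(∂ⱼ vᵢ)(0)`. -/
def FormalVectorField.linearization (b : Module.Basis (Fin d) ℝ V) (v : FormalVectorField d) :
    Module.End ℝ V :=
  Matrix.toLin b b (Matrix.of fun i j => MvPowerSeries.coeff (Finsupp.single j 1) (v.comp i))

/-- The linear vector field `x ↦ A x` on `V`, in the coordinates of the basis `b`. -/
def linearVectorField (b : Module.Basis (Fin d) ℝ V) (A : Module.End ℝ V) :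
    FormalVectorField d where
  comp i := ∑ j, LinearMap.toMatrix b b A i j • MvPowerSeries.X j
  vanishes i := by simp [MvPowerSeries.smul_eq_C_mul]

/-- `μ₁, …, μ_d` are the eigenvalues of the semisimple part `s` in the Jordan decomposition
`A = s + n` on `V_ℂ`, with respect to a basis `e` of `V_ℂ` of eigenvectors of `s`. -/
def IsEigenvalueFamily (A : Module.End ℝ V) (μ : Fin d → ℂ) : Prop :=
  ∃ (s n : Module.End ℂ (ℂ ⊗[ℝ] V)) (e : Module.Basis (Fin d) ℂ (ℂ ⊗[ℝ] V)),
    LinearMap.baseChange ℂ A = s + n ∧ Commute s n ∧ IsNilpotent n ∧ ∀ j, s (e j) = μ j • e j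

end Linear

/-- The spectrum in `ℂ` of the complexification of a real linear operator. -/
def complexSpectrum {W : Type*} [AddCommGroup W] [Module ℝ W] (A : Module.End ℝ W) : Set ℂ :=
  spectrum ℂ (LinearMap.baseChange ℂ A : Module.End ℂ (ℂ ⊗[ℝ] W))

/-! ### Compact simple Lie algebras -/

/-- A finite-dimensional real Lie algebra is compact simple (the Lie algebra of a compact simple
Lie group) if it is simple and its Killing form is negative definite. -/
structure IsCompactSimple (k : Type*) [LieRing k] [LieAlgebra ℝ k] : Prop where
  finite : FiniteDimensional ℝ k
  simple : LieAlgebra.IsSimple ℝ k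
  negDef : ∀ X : k, X ≠ 0 → killingForm ℝ k X X < 0

section Roots

variable {k : Type*} [LieRing k] [LieAlgebra ℝ k]

/-- A maximal torus of `𝔨`: a maximal abelian subalgebra. -/
def IsMaximalTorus (t : LieSubalgebra ℝ k) : Prop :=
  Maximal (fun s : LieSubalgebra ℝ k => IsLieAbelian s) t

/-- `α : 𝔱 → ℂ` is a root of `𝔨` with respect to `𝔱`: it is nonzero and has a nonzero root space
in `𝔨_ℂ`. -/
def IsRoot (t : LieSubalgebra ℝ k) (α : t →ₗ[ℝ] ℂ) : Prop :=
  α ≠ 0 ∧ ∃ x : ℂ ⊗[ℝ] k, x ≠ 0 ∧ ∀ H : t, ⁅((1 : ℂ) ⊗ₜ[ℝ] (H : k) : ℂ ⊗[ℝ] k), x⁆ = α H • x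

end Roots

/-! ### Gauge equivalence and circle actions -/

section Gauge

variable {d : ℕ} {k : Type*} [LieRing k] [LieAlgebra ℝ k]

/-- `y = e^{ad_ξ} ζ`, with `e^w = ∑ₙ wⁿ / n!`. -/
def IsExpAd (ξ ζ y : JetAlgebra d k) : Prop :=
  HasSum (fun n : ℕ => ((n ! : ℝ)⁻¹) • (adJet ξ ^ n) ζ) y

/-- `y = F(ad_ξ) ζ`, with `F(w) = -∑ₙ wⁿ / (n+1)!`. -/
def IsFAd (ξ ζ y : JetAlgebra d k) : Prop :=
  HasSum (fun n : ℕ => -((((n + 1)! : ℕ) : ℝ)⁻¹ • (adJet ξ ^ n) ζ)) y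

/-- `σ` and `η` are gauge-equivalent (for the fixed horizontal part `v`): there is `ξ ∈ 𝔤` with
`η = e^{ad_ξ} σ + F(ad_ξ)(-L_v ξ)`. -/
def GaugeEquiv (v : FormalVectorField d) (σ η : JetAlgebra d k) : Prop :=
  ∃ ξ y z : JetAlgebra d k, IsExpAd ξ σ y ∧ IsFAd ξ (-(v.lieJet k ξ)) z ∧ η = y + z

/-- A continuous action of the circle `ℝ/Tℤ` on `𝔤` by Lie algebra automorphisms. -/
structure CircleAction (T : ℝ) (d : ℕ) (k : Type*) [LieRing k] [LieAlgebra ℝ k] where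
  act : AddCircle T → (JetAlgebra d k →ₗ⁅ℝ⁆ JetAlgebra d k)
  act_zero : ∀ ξ, act 0 ξ = ξ
  act_add : ∀ s t ξ, act (s + t) ξ = act s (act t ξ)
  continuous_act : Continuous fun p : AddCircle T × JetAlgebra d k => act p.1 p.2

/-- The operator `D` on `𝔤` integrates to a continuous action of `ℝ/Tℤ`: it is the infinitesimal
generator `d/dt|_{t=0}` of such an action. -/
def IntegratesToCircleAction (T : ℝ) (D : Module.End ℝ (JetAlgebra d k)) : Prop :=
  ∃ ρ : CircleAction T d k, ∀ ξ : JetAlgebra d k,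
    Filter.Tendsto (fun t : ℝ => t⁻¹ • (ρ.act (t : AddCircle T) ξ - ξ)) (𝓝[≠] 0) (𝓝 (D ξ))

end Gauge

end JetTwist

end

open JetTwist

open scoped TensorProduct Topology Nat

noncomputable section

namespace JetTwist

/-! ### Jets as formal power series with coefficients in `𝔨`. -/

section Coefficients

variable {d : ℕ} {k : Type*} [LieRing k] [LieAlgebra ℝ k]

/-! Write `D = -L_v + ad_σ` and filter `𝔤` by order of vanishing at the origin. For `ξ` vanishing at
the origin, the gauge transform of `σ` by `ξ` is `η = σ - ∑ ad_ξⁿ(Dξ)/(n+1)!`. Changing `ξ` by some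
`x` of order `N+1` changes `η` by `A x` modulo order `N+2`, where `A = L_{v_l} - ad_{σ₀}` is
homogeneous of degree zero and `D + A` raises the order (`IsGaugeTransform.step`). So a normal form
can be built one degree at a time as soon as, in each degree `N ≥ 1`, every homogeneous jet can be
moved into a chosen subspace `S` by adding an element of the range of `A`
(`exists_gauge_normal_form`).

For the first two claims, complexify. On `f ⊗ x` with `[σ₀, x] = c x`, the operator `A` acts as
`L_{v_l} - c` on the polynomial `f`, and the generalized eigenvalues of `L_{v_l}` in degree `N` are
the numbers `⟨n, μ⟩` with `|n| = N`. Non-resonance makes `L_{v_l} - α(σ₀)` invertible on the root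
parts, so only the `𝔱`-part survives. If `v_l` is semisimple, then so is `A`, because `ad_{σ₀}` is
semisimple by definiteness of the Killing form; range and kernel of `A` then span, and `S = ker A`
works.

For a circle action, every solution of `y' = D y` modulo a power of the maximal ideal is
`T`-periodic (`flow_periodic`). If `A²X = 0`, then `X - tAX` is such a solution modulo the next
order, so periodicity gives `AX = 0`. Thus `A` has no Jordan blocks at zero, and there is a normal
form `ν` with `Aν = 0` and constant term `σ₀`. Put `p = ν - σ₀`. For linear `v` the twisted
derivative of `ν` is `-A + ad_p`, with commuting summands, so to leading order of `p` its flow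
carries a secular term `t [p, ·]`. The operator `e^{-ad_ξ}` transports this flow to that of `D`
(`IsGaugeTransform.exists_intertwiner`); periodicity makes the leading part of `p` central, hence
zero. Inductively `ν = σ₀`.

The spectra of `v_l` and `ad_{σ₀}` are read off from the solutions `e^{(c-a)t} f ⊗ x` with `f`, `x`
eigenvectors. For `ad_σ`, a Neumann series shows that the part of `ad_σ` raising the order adds no
spectrum to that of `ad_{σ₀}`. -/

@[simp]
theorem jetCoeff_tmul (n : Fin d →₀ ℕ) (f : FormalSeries d) (X : k) :
    jetCoeff n (f ⊗ₜ[ℝ] X : JetAlgebra d k) = MvPowerSeries.coeff n f • X := by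
  simp [jetCoeff]

/-- The `R`-valued coordinate of a jet with respect to a linear functional on `𝔨`. -/
def jetCoord (l : Module.Dual ℝ k) : JetAlgebra d k →ₗ[ℝ] FormalSeries d :=
  (TensorProduct.rid ℝ _).toLinearMap ∘ₗ LinearMap.lTensor _ l

theorem coeff_jetCoord (l : Module.Dual ℝ k) (n : Fin d →₀ ℕ) (ξ : JetAlgebra d k) :
    MvPowerSeries.coeff n (jetCoord l ξ) = l (jetCoeff n ξ) := by
  induction ξ using TensorProduct.induction_on with
  | zero => simp
  | tmul f X => simp [jetCoord, mul_comm]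
  | add x y hx hy => simp [hx, hy]

theorem sum_jetCoord_tmul {ι : Type*} [Fintype ι] (e : Module.Basis ι ℝ k)
    (ξ : JetAlgebra d k) : ∑ i, jetCoord (e.coord i) ξ ⊗ₜ[ℝ] e i = ξ := by
  induction ξ using TensorProduct.induction_on with
  | zero => simp
  | tmul f X =>
    simp only [jetCoord, LinearMap.coe_comp, LinearEquiv.coe_coe, Function.comp_apply,
      LinearMap.lTensor_tmul, TensorProduct.rid_tmul, TensorProduct.smul_tmul]
    rw [← TensorProduct.tmul_sum]
    congr 1
    exact e.sum_repr X
  | add x y hx hy => simp only [map_add, TensorProduct.add_tmul, Finset.sum_add_distrib, hx, hy]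

theorem jet_ext [FiniteDimensional ℝ k] {ξ η : JetAlgebra d k}
    (h : ∀ n, jetCoeff n ξ = jetCoeff n η) : ξ = η := by
  rw [← sum_jetCoord_tmul (Module.finBasis ℝ k) ξ, ← sum_jetCoord_tmul (Module.finBasis ℝ k) η]
  refine Finset.sum_congr rfl fun i _ => ?_
  congr 1
  ext n
  simp only [coeff_jetCoord, h]

/-- Together with `jet_ext`, this identifies `R ⊗ 𝔨` with `𝔨`-valued power series; finite dimension
of `𝔨` is what allows infinitely many independent coefficients in a finite sum of tensors. -/
theorem exists_jet [FiniteDimensional ℝ k] (u : (Fin d →₀ ℕ) → k) :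
    ∃ ξ : JetAlgebra d k, ∀ n, jetCoeff n ξ = u n := by
  let e := Module.finBasis ℝ k
  refine ⟨∑ i, (fun n => e.coord i (u n) : FormalSeries d) ⊗ₜ[ℝ] e i, fun n => ?_⟩
  rw [map_sum, ← e.sum_repr (u n)]
  exact Finset.sum_congr rfl fun i _ => jetCoeff_tmul n _ _

/-- The Lie bracket of `𝔤` as a bilinear map. -/
def jetBracket : JetAlgebra d k →ₗ[ℝ] JetAlgebra d k →ₗ[ℝ] JetAlgebra d k :=
  (LieAlgebra.ad ℝ (JetAlgebra d k) : JetAlgebra d k →ₗ[ℝ] Module.End ℝ (JetAlgebra d k))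

theorem lie_eq_jetBracket (ξ η : JetAlgebra d k) : ⁅ξ, η⁆ = jetBracket ξ η := rfl

@[simp]
theorem jetBracket_tmul (f g : FormalSeries d) (X Y : k) :
    jetBracket (f ⊗ₜ[ℝ] X : JetAlgebra d k) (g ⊗ₜ[ℝ] Y) = (f * g) ⊗ₜ[ℝ] ⁅X, Y⁆ := rfl

theorem jetBracket_skew (ξ η : JetAlgebra d k) : -jetBracket ξ η = jetBracket η ξ :=
  lie_skew η ξ

theorem jetBracket_self (ξ : JetAlgebra d k) : jetBracket ξ ξ = 0 := lie_self ξ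

theorem jetBracket_jacobi (ξ η ζ : JetAlgebra d k) :
    jetBracket ξ (jetBracket η ζ) =
      jetBracket (jetBracket ξ η) ζ + jetBracket η (jetBracket ξ ζ) :=
  LieRing.leibniz_lie ξ η ζ

theorem jetCoeff_bracket (n : Fin d →₀ ℕ) (ξ η : JetAlgebra d k) :
    jetCoeff n (jetBracket ξ η) =
      ∑ p ∈ Finset.HasAntidiagonal.antidiagonal n, ⁅jetCoeff p.1 ξ, jetCoeff p.2 η⁆ := by
  induction ξ using TensorProduct.induction_on with
  | zero => simp
  | add x y hx hy => simp [hx, hy, Finset.sum_add_distrib]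
  | tmul f X =>
    induction η using TensorProduct.induction_on with
    | zero => simp
    | add x y hx hy => simp only [map_add, hx, hy, lie_add, Finset.sum_add_distrib]
    | tmul g Y =>
      simp [MvPowerSeries.coeff_mul, Finset.sum_smul, smul_smul, mul_comm]

theorem jetCoeff_lieJet (v : FormalVectorField d) (n : Fin d →₀ ℕ) (ξ : JetAlgebra d k) :
    jetCoeff n (v.lieJet k ξ) =
      ∑ i, ∑ p ∈ Finset.HasAntidiagonal.antidiagonal n, (MvPowerSeries.coeff p.1 (v.comp i) * (p.2 i + 1 : ℝ)) •
        jetCoeff (p.2 + Finsupp.single i 1) ξ := by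
  induction ξ using TensorProduct.induction_on with
  | zero => simp
  | add x y hx hy => simp only [map_add, hx, hy, smul_add, Finset.sum_add_distrib]
  | tmul f X =>
    have h1 : v.lieDerivative f = ∑ i, v.comp i * MvPowerSeries.pderiv ℝ i f := by
      simp only [FormalVectorField.lieDerivative]
      rw [← Derivation.coeFnAddMonoidHom_apply, map_sum]
      simp
    simp only [FormalVectorField.lieJet, LinearMap.rTensor_tmul, jetCoeff_tmul,
      Derivation.coeFn_coe, h1, map_sum, MvPowerSeries.coeff_mul, MvPowerSeries.coeff_pderiv,
      Finset.sum_smul, smul_smul]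
    refine Finset.sum_congr rfl fun i _ => Finset.sum_congr rfl fun p _ => ?_
    congr 1; ring

theorem lieJet_bracket (v : FormalVectorField d) (ξ η : JetAlgebra d k) :
    v.lieJet k (jetBracket ξ η) =
      jetBracket (v.lieJet k ξ) η + jetBracket ξ (v.lieJet k η) := by
  induction ξ using TensorProduct.induction_on with
  | zero => simp
  | add x y hx hy => simp only [map_add, LinearMap.add_apply, hx, hy]; abel
  | tmul f X =>
    induction η using TensorProduct.induction_on with
    | zero => simp
    | add x y hx hy => simp only [map_add, hx, hy]; abel
    | tmul g Y =>
      simp only [FormalVectorField.lieJet, LinearMap.rTensor_tmul, Derivation.coeFn_coe,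
        jetBracket_tmul, Derivation.leibniz, smul_eq_mul, TensorProduct.add_tmul]
      rw [add_comm, mul_comm g]

@[simp]
theorem jetCoeff_zero_constJet (X : k) : jetCoeff 0 (constJet d X) = X := by
  simp [constJet]

theorem jetCoeff_constJet_of_ne {n : Fin d →₀ ℕ} (hn : n ≠ 0) (X : k) :
    jetCoeff n (constJet d X) = 0 := by
  classical
  simp [constJet, MvPowerSeries.coeff_one, hn]

theorem jetCoeff_constJet_bracket (n : Fin d →₀ ℕ) (X : k) (ξ : JetAlgebra d k) :
    jetCoeff n (jetBracket (constJet d X) ξ) = ⁅X, jetCoeff n ξ⁆ := by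
  induction ξ using TensorProduct.induction_on with
  | zero => simp
  | add x y hx hy => simp only [map_add, lie_add, hx, hy]
  | tmul f Y => simp [constJet]

theorem lieJet_constJet (v : FormalVectorField d) (X : k) : v.lieJet k (constJet d X) = 0 := by
  simp [constJet, FormalVectorField.lieJet]

/-- The homogeneous jet `x^n ⊗ X`. -/
def monoJet (n : Fin d →₀ ℕ) : k →ₗ[ℝ] JetAlgebra d k :=
  TensorProduct.mk ℝ (FormalSeries d) k (MvPowerSeries.monomial n 1)

theorem jetCoeff_monoJet [DecidableEq (Fin d →₀ ℕ)] (m n : Fin d →₀ ℕ) (X : k) :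
    jetCoeff m (monoJet n X) = if m = n then X else 0 := by
  simp [monoJet, MvPowerSeries.coeff_monomial]

end Coefficients

/-! ### The filtration by order of vanishing and its graded pieces. -/

section Filtration

variable {d : ℕ} {k : Type*} [LieRing k] [LieAlgebra ℝ k]

variable (d k) in
/-- The jets vanishing to order `N` at the origin, `I^N 𝔤`. -/
def jetFil (N : ℕ) : Submodule ℝ (JetAlgebra d k) where
  carrier := {ξ | ∀ n, n.degree < N → jetCoeff n ξ = 0}
  add_mem' h h' n hn := by rw [map_add, h n hn, h' n hn, add_zero]
  zero_mem' n _ := map_zero _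
  smul_mem' c ξ h n hn := by rw [map_smul, h n hn, smul_zero]

variable (d k) in
/-- The homogeneous jets of degree `N`. -/
def jetGr (N : ℕ) : Submodule ℝ (JetAlgebra d k) where
  carrier := {ξ | ∀ n, n.degree ≠ N → jetCoeff n ξ = 0}
  add_mem' h h' n hn := by rw [map_add, h n hn, h' n hn, add_zero]
  zero_mem' n _ := map_zero _
  smul_mem' c ξ h n hn := by rw [map_smul, h n hn, smul_zero]

theorem jetFil_anti {M N : ℕ} (h : M ≤ N) : jetFil d k N ≤ jetFil d k M :=
  fun _ hξ n hn => hξ n (hn.trans_le h)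

theorem jetGr_le_jetFil (N : ℕ) : jetGr d k N ≤ jetFil d k N :=
  fun _ hξ n hn => hξ n hn.ne

theorem mem_jetFil_zero (ξ : JetAlgebra d k) : ξ ∈ jetFil d k 0 :=
  fun _ hn => absurd hn (Nat.not_lt_zero _)

theorem mem_jetFil_one {ξ : JetAlgebra d k} : ξ ∈ jetFil d k 1 ↔ jetCoeff 0 ξ = 0 := by
  refine ⟨fun h => h 0 (by simp), fun h n hn => ?_⟩
  rwa [(Finsupp.degree_eq_zero_iff n).1 (Nat.lt_one_iff.1 hn)]

theorem eq_of_forall_sub_mem_jetFil [FiniteDimensional ℝ k] {ξ η : JetAlgebra d k}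
    (h : ∀ N, ξ - η ∈ jetFil d k N) : ξ = η :=
  jet_ext fun n => by
    rw [← sub_eq_zero, ← map_sub]; exact h (n.degree + 1) n (Nat.lt_succ_self _)

theorem eq_zero_of_mem_jetGr [FiniteDimensional ℝ k] {N : ℕ} {ξ : JetAlgebra d k}
    (h : ξ ∈ jetGr d k N) (h' : ξ ∈ jetFil d k (N + 1)) : ξ = 0 :=
  jet_ext fun n => by
    rw [map_zero]
    by_cases hn : n.degree = N
    · exact h' n (by omega)
    · exact h n hn

theorem bracket_mem_jetFil {M N : ℕ} {ξ η : JetAlgebra d k} (hξ : ξ ∈ jetFil d k M)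
    (hη : η ∈ jetFil d k N) : jetBracket ξ η ∈ jetFil d k (M + N) := by
  intro n hn
  rw [jetCoeff_bracket]
  refine Finset.sum_eq_zero fun p hp => ?_
  have : p.1.degree + p.2.degree = n.degree := by
    rw [← Finset.HasAntidiagonal.mem_antidiagonal.1 hp, map_add]
  rcases lt_or_ge p.1.degree M with h | h
  · rw [hξ _ h, zero_lie]
  · rw [hη _ (by omega), lie_zero]

theorem bracket_mem_jetFil_right {N : ℕ} (ξ : JetAlgebra d k) {η : JetAlgebra d k}
    (hη : η ∈ jetFil d k N) : jetBracket ξ η ∈ jetFil d k N := by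
  simpa using bracket_mem_jetFil (mem_jetFil_zero ξ) hη

theorem bracket_mem_jetFil_left {N : ℕ} {ξ : JetAlgebra d k} (hξ : ξ ∈ jetFil d k N)
    (η : JetAlgebra d k) : jetBracket ξ η ∈ jetFil d k N := by
  simpa using bracket_mem_jetFil hξ (mem_jetFil_zero η)

theorem constJet_bracket_mem_jetGr {N : ℕ} (X : k) {ξ : JetAlgebra d k} (hξ : ξ ∈ jetGr d k N) :
    jetBracket (constJet d X) ξ ∈ jetGr d k N := by
  intro n hn
  rw [jetCoeff_constJet_bracket, hξ n hn, lie_zero]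

/-- A derivative lowers the order by one, and the components of `v`, having no constant term,
restore it. -/
theorem lieJet_mem_jetFil (v : FormalVectorField d) {N : ℕ} {ξ : JetAlgebra d k}
    (hξ : ξ ∈ jetFil d k N) : v.lieJet k ξ ∈ jetFil d k N := by
  intro n hn
  rw [jetCoeff_lieJet]
  refine Finset.sum_eq_zero fun i _ => Finset.sum_eq_zero fun p hp => ?_
  have h : p.1.degree + p.2.degree = n.degree := by
    rw [← Finset.HasAntidiagonal.mem_antidiagonal.1 hp, map_add]
  rcases Nat.eq_zero_or_pos p.1.degree with h0 | h0
  · have := v.vanishes i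
    rw [← MvPowerSeries.coeff_zero_eq_constantCoeff_apply] at this
    rw [(Finsupp.degree_eq_zero_iff _).1 h0, this, zero_mul, zero_smul]
  · rw [hξ, smul_zero]
    rw [map_add, Finsupp.degree_single]; omega

/-- The linear part of a formal vector field. -/
def FormalVectorField.linearPart (v : FormalVectorField d) : FormalVectorField d where
  comp i := ∑ j, MvPowerSeries.coeff (Finsupp.single j 1) (v.comp i) • MvPowerSeries.X j
  vanishes i := by simp [MvPowerSeries.smul_eq_C_mul]

theorem linearVectorField_linearization {V : Type*} [AddCommGroup V] [Module ℝ V]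
    (b : Module.Basis (Fin d) ℝ V) (v : FormalVectorField d) :
    linearVectorField b (v.linearization b) = v.linearPart := by
  simp [linearVectorField, FormalVectorField.linearization, FormalVectorField.linearPart]

theorem coeff_linearPart_of_ne (v : FormalVectorField d) (i : Fin d) {n : Fin d →₀ ℕ}
    (hn : n.degree ≠ 1) : MvPowerSeries.coeff n (v.linearPart.comp i) = 0 := by
  classical
  simp only [FormalVectorField.linearPart, map_sum, MvPowerSeries.coeff_smul,
    MvPowerSeries.coeff_X]
  refine Finset.sum_eq_zero fun j _ => ?_
  rw [if_neg, mul_zero]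
  rintro rfl
  exact hn (Finsupp.degree_single _ _)

theorem coeff_linearPart (v : FormalVectorField d) (i : Fin d) {n : Fin d →₀ ℕ}
    (hn : n.degree ≤ 1) :
    MvPowerSeries.coeff n (v.linearPart.comp i) = MvPowerSeries.coeff n (v.comp i) := by
  classical
  rcases Nat.le_one_iff_eq_zero_or_eq_one.1 hn with h | h
  · rw [(Finsupp.degree_eq_zero_iff _).1 h, MvPowerSeries.coeff_zero_eq_constantCoeff_apply,
      MvPowerSeries.coeff_zero_eq_constantCoeff_apply, v.vanishes, v.linearPart.vanishes]
  · obtain ⟨j, rfl⟩ : ∃ j, n = Finsupp.single j 1 :=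
      (Finsupp.sum_eq_one_iff n).1 h
    simp only [FormalVectorField.linearPart, map_sum, MvPowerSeries.coeff_smul,
      MvPowerSeries.coeff_X]
    rw [Finset.sum_eq_single j]
    · simp
    · intro m _ hm
      rw [if_neg, mul_zero]
      intro h
      exact hm (Finsupp.single_left_injective one_ne_zero h).symm
    · simp

/-- Terms of `v` of degree at least two raise the order by at least one, so only the linear part
acts on the graded pieces. -/
theorem lieJet_sub_linearPart_mem (v : FormalVectorField d) {N : ℕ} {ξ : JetAlgebra d k}
    (hξ : ξ ∈ jetFil d k N) : v.lieJet k ξ - v.linearPart.lieJet k ξ ∈ jetFil d k (N + 1) := by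
  intro n hn
  rw [map_sub, jetCoeff_lieJet, jetCoeff_lieJet, sub_eq_zero]
  refine Finset.sum_congr rfl fun i _ => Finset.sum_congr rfl fun p hp => ?_
  have h : p.1.degree + p.2.degree = n.degree := by
    rw [← Finset.HasAntidiagonal.mem_antidiagonal.1 hp, map_add]
  rcases le_or_gt p.1.degree 1 with h0 | h0
  · rw [coeff_linearPart v i h0]
  · rw [hξ, smul_zero, smul_zero]
    rw [map_add, Finsupp.degree_single]; omega

theorem linearPart_lieJet_mem_jetGr (v : FormalVectorField d) {N : ℕ} {ξ : JetAlgebra d k}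
    (hξ : ξ ∈ jetGr d k N) : v.linearPart.lieJet k ξ ∈ jetGr d k N := by
  intro n hn
  rw [jetCoeff_lieJet]
  refine Finset.sum_eq_zero fun i _ => Finset.sum_eq_zero fun p hp => ?_
  have h : p.1.degree + p.2.degree = n.degree := by
    rw [← Finset.HasAntidiagonal.mem_antidiagonal.1 hp, map_add]
  by_cases h0 : p.1.degree = 1
  · rw [hξ, smul_zero]
    rw [map_add, Finsupp.degree_single]; omega
  · rw [coeff_linearPart_of_ne v i h0, zero_mul, zero_smul]

variable (d k) in
/-- The projection to the homogeneous component of degree `N`. -/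
def jetProj (N : ℕ) : JetAlgebra d k →ₗ[ℝ] JetAlgebra d k :=
  LinearMap.rTensor k
    { toFun := fun f n => if n.degree = N then f n else 0
      map_add' := fun f g => funext fun n => by
        change (if _ then f n + g n else 0) = (if _ then f n else 0) + if _ then g n else 0
        split_ifs <;> simp
      map_smul' := fun c f => funext fun n => by
        change (if _ then c * f n else 0) = c * if _ then f n else 0
        split_ifs <;> simp }

theorem jetCoeff_jetProj (N : ℕ) (n : Fin d →₀ ℕ) (ξ : JetAlgebra d k) :
    jetCoeff n (jetProj d k N ξ) = if n.degree = N then jetCoeff n ξ else 0 := by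
  induction ξ using TensorProduct.induction_on with
  | zero => simp
  | add x y hx hy => rw [map_add, map_add, hx, hy, map_add]; split_ifs <;> simp
  | tmul f X =>
    simp only [jetProj, LinearMap.rTensor_tmul, jetCoeff_tmul]
    change (if n.degree = N then f n else 0) • X = _
    split_ifs
    · rfl
    · rw [zero_smul]

theorem jetProj_mem (N : ℕ) (ξ : JetAlgebra d k) : jetProj d k N ξ ∈ jetGr d k N := by
  intro n hn
  rw [jetCoeff_jetProj, if_neg hn]

theorem sub_jetProj_mem [FiniteDimensional ℝ k] {N : ℕ} {ξ : JetAlgebra d k}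
    (hξ : ξ ∈ jetFil d k N) : ξ - jetProj d k N ξ ∈ jetFil d k (N + 1) := by
  intro n hn
  rw [map_sub, jetCoeff_jetProj]
  split_ifs with h
  · exact sub_self _
  · rw [hξ n (by omega), sub_zero]

theorem jetProj_eq_of_sub_mem [FiniteDimensional ℝ k] {N : ℕ} {ξ η : JetAlgebra d k}
    (h : ξ - η ∈ jetFil d k (N + 1)) : jetProj d k N ξ = jetProj d k N η :=
  jet_ext fun n => by
    rw [jetCoeff_jetProj, jetCoeff_jetProj]
    split_ifs with hn
    · rw [← sub_eq_zero, ← map_sub]; exact h n (by omega)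
    · rfl

theorem jetProj_of_mem [FiniteDimensional ℝ k] {N : ℕ} {ξ : JetAlgebra d k}
    (h : ξ ∈ jetGr d k N) : jetProj d k N ξ = ξ :=
  jet_ext fun n => by
    rw [jetCoeff_jetProj]
    split_ifs with hn
    · rfl
    · exact (h n hn).symm

end Filtration

/-! ### Gauge transforms and the degree-by-degree normal form. -/

section Gauge

variable {d : ℕ} {k : Type*} [LieRing k] [LieAlgebra ℝ k]

theorem hasSum_jet {ι : Type*} {u : ι → JetAlgebra d k} {y : JetAlgebra d k}
    (h : ∀ (n : Fin d →₀ ℕ) (l : Module.Dual ℝ k),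
      HasSum (fun i => l (jetCoeff n (u i))) (l (jetCoeff n y))) : HasSum u y := by
  simp only [HasSum, nhds_iInf, Filter.tendsto_iInf, nhds_induced,
    Filter.tendsto_comap_iff]
  intro n l
  refine (h n l).congr fun s => ?_
  simp only [Function.comp_apply, map_sum]

/-- Only finitely many terms contribute to a given coefficient, so the series converges in the
product topology and its partial sums are exact modulo the filtration. -/
theorem exists_hasSum_jet [FiniteDimensional ℝ k] (u : ℕ → JetAlgebra d k)
    (hu : ∀ n, u n ∈ jetFil d k n) :
    ∃ y, HasSum u y ∧ ∀ N, y - ∑ n ∈ Finset.range N, u n ∈ jetFil d k N := by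
  obtain ⟨y, hy⟩ := exists_jet (d := d) (k := k) fun n =>
    jetCoeff n (∑ m ∈ Finset.range (n.degree + 1), u m)
  refine ⟨y, hasSum_jet fun n l => ?_, fun N n hn => ?_⟩
  · rw [hy, map_sum, map_sum]
    refine hasSum_sum_of_ne_finset_zero fun m hm => ?_
    rw [hu m n (by simpa using hm), map_zero]
  · rw [map_sub, hy, sub_eq_zero, map_sum, map_sum]
    refine Finset.sum_subset (Finset.range_subset_range.2 hn) fun m _ hm => ?_
    exact hu m n (by simpa using hm)

/-- The twisted Lie derivative `-L_v + ad_σ`. -/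
def twistedDerivative (v : FormalVectorField d) (σ : JetAlgebra d k) :
    Module.End ℝ (JetAlgebra d k) :=
  -(v.lieJet k) + jetBracket σ

/-- The operator `L_{v_l} - ad_{σ₀}` on `𝔤`. -/
def homologicalOperator (v : FormalVectorField d) (X : k) :
    Module.End ℝ (JetAlgebra d k) :=
  v.linearPart.lieJet k - jetBracket (constJet d X)

theorem twistedDerivative_apply (v : FormalVectorField d) (σ ξ : JetAlgebra d k) :
    twistedDerivative v σ ξ = -(v.lieJet k ξ) + jetBracket σ ξ := rfl

theorem homologicalOperator_apply (v : FormalVectorField d) (X : k) (ξ : JetAlgebra d k) :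
    homologicalOperator v X ξ = v.linearPart.lieJet k ξ - jetBracket (constJet d X) ξ := rfl

theorem twistedDerivative_mem_jetFil (v : FormalVectorField d) (σ : JetAlgebra d k) {N : ℕ}
    {ξ : JetAlgebra d k} (hξ : ξ ∈ jetFil d k N) : twistedDerivative v σ ξ ∈ jetFil d k N :=
  add_mem (neg_mem (lieJet_mem_jetFil v hξ)) (bracket_mem_jetFil_right σ hξ)

theorem homologicalOperator_mem_jetGr (v : FormalVectorField d) (X : k) {N : ℕ}
    {ξ : JetAlgebra d k} (hξ : ξ ∈ jetGr d k N) : homologicalOperator v X ξ ∈ jetGr d k N :=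
  sub_mem (linearPart_lieJet_mem_jetGr v hξ) (constJet_bracket_mem_jetGr X hξ)

theorem homologicalOperator_mem_jetFil (v : FormalVectorField d) (X : k) {N : ℕ}
    {ξ : JetAlgebra d k} (hξ : ξ ∈ jetFil d k N) : homologicalOperator v X ξ ∈ jetFil d k N :=
  sub_mem (lieJet_mem_jetFil _ hξ) (bracket_mem_jetFil_right _ hξ)

theorem sub_constJet_mem_jetFil_one (σ : JetAlgebra d k) :
    σ - constJet d (ev0 σ) ∈ jetFil d k 1 := by
  rw [mem_jetFil_one, map_sub, jetCoeff_zero_constJet]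
  exact sub_self _

/-- On graded pieces `D` acts as `-A`: both `σ - σ₀` and the nonlinear part of `v` raise the order.
-/
theorem twistedDerivative_add_homologicalOperator_mem (v : FormalVectorField d)
    (σ : JetAlgebra d k) {N : ℕ} {ξ : JetAlgebra d k} (hξ : ξ ∈ jetFil d k N) :
    twistedDerivative v σ ξ + homologicalOperator v (ev0 σ) ξ ∈ jetFil d k (N + 1) := by
  have h1 := lieJet_sub_linearPart_mem v hξ
  have h2 := bracket_mem_jetFil (sub_constJet_mem_jetFil_one σ) hξ
  rw [add_comm 1] at h2
  convert sub_mem h2 h1 using 1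
  rw [twistedDerivative_apply, homologicalOperator_apply, map_sub, LinearMap.sub_apply]
  abel

/-- `η` is the gauge transform of `σ` by `ξ`, expressed by the partial sums of
`η = σ - ∑ₙ ad_ξⁿ (D ξ) / (n+1)!` with `D = -L_v + ad_σ`. -/
def IsGaugeTransform (v : FormalVectorField d) (σ ξ η : JetAlgebra d k) : Prop :=
  ∀ N, η - (σ - ∑ n ∈ Finset.range N,
    (((n + 1)! : ℕ) : ℝ)⁻¹ • (jetBracket ξ ^ n) (twistedDerivative v σ ξ)) ∈ jetFil d k N

theorem bracket_pow_mem_jetFil {ξ : JetAlgebra d k} (hξ : ξ ∈ jetFil d k 1) (n : ℕ) {N : ℕ}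
    {ζ : JetAlgebra d k} (hζ : ζ ∈ jetFil d k N) :
    (jetBracket ξ ^ n) ζ ∈ jetFil d k (n + N) := by
  induction n with
  | zero => simpa using hζ
  | succ n ih =>
    rw [pow_succ', Module.End.mul_apply]
    have := bracket_mem_jetFil hξ ih
    rwa [← add_assoc, add_comm 1 n] at this

theorem exists_isGaugeTransform [FiniteDimensional ℝ k] (v : FormalVectorField d)
    (σ : JetAlgebra d k) {ξ : JetAlgebra d k} (hξ : ξ ∈ jetFil d k 1) :
    ∃ η y z, IsExpAd ξ σ y ∧ IsFAd ξ (-(v.lieJet k ξ)) z ∧ η = y + z ∧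
      IsGaugeTransform v σ ξ η := by
  obtain ⟨y, hy, hy'⟩ := exists_hasSum_jet (fun n : ℕ => ((n ! : ℝ)⁻¹) • (jetBracket ξ ^ n) σ)
    fun n => Submodule.smul_mem _ _ (by simpa using bracket_pow_mem_jetFil hξ n (mem_jetFil_zero σ))
  obtain ⟨z, hz, hz'⟩ := exists_hasSum_jet (fun n : ℕ =>
      -((((n + 1)! : ℕ) : ℝ)⁻¹ • (jetBracket ξ ^ n) (-(v.lieJet k ξ))))
    fun n => neg_mem (Submodule.smul_mem _ _
      (by simpa using bracket_pow_mem_jetFil hξ n (mem_jetFil_zero (-(v.lieJet k ξ)))))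
  refine ⟨y + z, y, z, hy, hz, rfl, fun N => ?_⟩
  -- The exponential needs one more term: after splitting off `σ`, its index shifts by one and `[ξ,
  -- σ] = -[σ, ξ]` merges it with the series `F`.
  convert add_mem (jetFil_anti (Nat.le_succ N) (hy' (N + 1))) (hz' N) using 1
  have : ∑ n ∈ Finset.range (N + 1), ((n ! : ℝ)⁻¹) • (jetBracket ξ ^ n) σ =
      σ - ∑ n ∈ Finset.range N, (((n + 1)! : ℕ) : ℝ)⁻¹ • (jetBracket ξ ^ n) (jetBracket σ ξ) := by
    rw [Finset.sum_range_succ', sub_eq_add_neg, add_comm, ← Finset.sum_neg_distrib]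
    congr 1
    · simp
    · refine Finset.sum_congr rfl fun n _ => ?_
      rw [← jetBracket_skew ξ σ, map_neg, smul_neg, neg_neg, pow_succ, Module.End.mul_apply]
  rw [this]
  simp only [twistedDerivative_apply, map_add, smul_add, Finset.sum_add_distrib,
    Finset.sum_neg_distrib]
  abel

/-- The linearization of the gauge action in the top order. Only the term `n = 0` of the series
responds to `x` modulo order `N + 2`, and it contributes `-D x`, which is `A x` there. -/
theorem IsGaugeTransform.step {v : FormalVectorField d} {σ ξ x η η' : JetAlgebra d k} {N : ℕ}
    (hξ : ξ ∈ jetFil d k 1) (hx : x ∈ jetFil d k (N + 1)) (h : IsGaugeTransform v σ ξ η)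
    (h' : IsGaugeTransform v σ (ξ + x) η') :
    η' - η - homologicalOperator v (ev0 σ) x ∈ jetFil d k (N + 2) := by
  have hx1 : x ∈ jetFil d k 1 := jetFil_anti (by omega) hx
  have key : ∀ n, (jetBracket (ξ + x) ^ (n + 1)) (twistedDerivative v σ (ξ + x)) -
      (jetBracket ξ ^ (n + 1)) (twistedDerivative v σ ξ) ∈ jetFil d k (N + 2) := by
    -- From `[ξ + x, a] - [ξ, b] = [x, a] + [ξ, a - b]`: each further bracket gains one order.
    have aux : ∀ a b : JetAlgebra d k, a ∈ jetFil d k 1 → a - b ∈ jetFil d k (N + 1) →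
        jetBracket (ξ + x) a - jetBracket ξ b ∈ jetFil d k (N + 2) := by
      intro a b ha hab
      have h1 := bracket_mem_jetFil hx ha
      have h2 := bracket_mem_jetFil hξ hab
      rw [add_comm 1] at h2
      convert add_mem h1 h2 using 1
      rw [map_sub, map_add, LinearMap.add_apply]
      abel
    have hD : twistedDerivative v σ (ξ + x) ∈ jetFil d k 1 :=
      twistedDerivative_mem_jetFil v σ (add_mem hξ hx1)
    intro n
    induction n with
    | zero =>
      simp only [zero_add, pow_one]
      refine aux _ _ hD ?_
      rw [← map_sub, add_sub_cancel_left]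
      exact twistedDerivative_mem_jetFil v σ hx
    | succ n ih =>
      rw [pow_succ', pow_succ' (jetBracket ξ), Module.End.mul_apply, Module.End.mul_apply]
      exact aux _ _ (jetFil_anti (by omega) (bracket_pow_mem_jetFil (add_mem hξ hx1) _ hD))
        (jetFil_anti (by omega) ih)
  obtain ⟨T, hT⟩ : ∃ T : JetAlgebra d k → ℕ → JetAlgebra d k, ∀ ζ n, T ζ n =
    (((n + 1)! : ℕ) : ℝ)⁻¹ • (jetBracket ζ ^ n) (twistedDerivative v σ ζ) := ⟨_, fun _ _ => rfl⟩
  have hT0 : ∀ ζ, T ζ 0 = twistedDerivative v σ ζ := fun ζ => by simp [hT]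
  have h1 := sub_mem (h' (N + 2)) (h (N + 2))
  have h2 : ∑ n ∈ Finset.range (N + 1), (T (ξ + x) (n + 1) - T ξ (n + 1)) ∈
      jetFil d k (N + 2) := by
    refine sum_mem fun n _ => ?_
    rw [hT, hT]
    convert Submodule.smul_mem _ ((((n + 1 + 1)! : ℕ) : ℝ)⁻¹) (key n) using 1
    exact (smul_sub _ _ _).symm
  have h3 := twistedDerivative_add_homologicalOperator_mem v σ hx
  simp only [← hT] at h1
  rw [Finset.sum_range_succ' (T (ξ + x)), Finset.sum_range_succ' (T ξ), hT0, hT0, map_add] at h1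
  rw [Finset.sum_sub_distrib] at h2
  convert sub_mem (sub_mem h1 h2) h3 using 1
  abel

/-- Successive corrections `x` of degree `N + 1` leave the components of degree at most `N`
untouched and change the next one by `A x`. They converge in the filtration. Keeping `ξ` of order
one also preserves the constant term. -/
theorem exists_gauge_normal_form [FiniteDimensional ℝ k] (v : FormalVectorField d)
    (σ : JetAlgebra d k) (S : Submodule ℝ (JetAlgebra d k))
    (hS : ∀ N, 1 ≤ N → ∀ ζ ∈ jetGr d k N, ∃ ξ ∈ jetGr d k N,
      ζ + homologicalOperator v (ev0 σ) ξ ∈ S) :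
    ∃ ξ ∈ jetFil d k 1, ∃ η y z, IsExpAd ξ σ y ∧ IsFAd ξ (-(v.lieJet k ξ)) z ∧ η = y + z ∧
      IsGaugeTransform v σ ξ η ∧ ev0 η = ev0 σ ∧ ∀ N, 1 ≤ N → jetProj d k N η ∈ S := by
  let P : ℕ → JetAlgebra d k → Prop := fun N ξ => ξ ∈ jetFil d k 1 ∧
    ∀ η, IsGaugeTransform v σ ξ η → ∀ j, 1 ≤ j → j ≤ N → jetProj d k j η ∈ S
  have step : ∀ N ξ, P N ξ → ∃ ξ', P (N + 1) ξ' ∧ ξ' - ξ ∈ jetFil d k (N + 1) := by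
    rintro N ξ ⟨h1, h2⟩
    obtain ⟨η, -, -, -, -, -, hη⟩ := exists_isGaugeTransform v σ h1
    obtain ⟨x, hx, hx'⟩ := hS (N + 1) (by omega) _ (jetProj_mem (N + 1) η)
    have hxF := jetGr_le_jetFil _ hx
    refine ⟨ξ + x, ⟨add_mem h1 (jetFil_anti (by omega) hxF), fun η' hη' j hj hjN => ?_⟩,
      by rwa [add_sub_cancel_left]⟩
    have h3 := hη.step h1 hxF hη'
    rcases Nat.le_succ_iff.1 hjN with h | h
    · rw [jetProj_eq_of_sub_mem (η := η) ?_]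
      · exact h2 η hη j hj h
      · have := add_mem (jetFil_anti (by omega : j + 1 ≤ N + 2) h3)
          (jetFil_anti (by omega : j + 1 ≤ N + 1) (homologicalOperator_mem_jetFil v (ev0 σ) hxF))
        rwa [sub_add_cancel] at this
    · subst h
      rw [sub_sub] at h3
      rw [jetProj_eq_of_sub_mem h3, map_add,
        jetProj_of_mem (homologicalOperator_mem_jetGr v (ev0 σ) hx)]
      exact hx'
  choose! next hnext hnext' using step
  have h0 : P 0 0 := ⟨zero_mem _, fun η _ j hj hj' => by omega⟩
  let f : ℕ → JetAlgebra d k := fun N => Nat.rec 0 (fun N ξ => next N ξ) N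
  have hf : ∀ N, P N (f N) := fun N => by
    induction N with
    | zero => exact h0
    | succ N ih => exact hnext N _ ih
  have hf' : ∀ m N, m ≤ N → f N - f m ∈ jetFil d k (m + 1) := by
    intro m N hmN
    induction N, hmN using Nat.le_induction with
    | base => rw [sub_self]; exact zero_mem _
    | succ N hmN ih =>
      rw [← sub_add_sub_cancel _ (f N)]
      exact add_mem (jetFil_anti (by omega) (hnext' N _ (hf N))) ih
  -- Diagonal limit: coefficients of degree at most `N` no longer change after stage `N`.
  obtain ⟨ξ, hξ⟩ := exists_jet (d := d) (k := k) fun n => jetCoeff n (f n.degree)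
  have hξf : ∀ N, ξ - f N ∈ jetFil d k (N + 1) := by
    intro N n hn
    rw [map_sub, hξ, ← map_sub, ← neg_sub, map_neg, hf' _ N (by omega) n (by omega), neg_zero]
  have hξ1 : ξ ∈ jetFil d k 1 := by simpa [f] using hξf 0
  obtain ⟨η, y, z, hy, hz, hyz, hη⟩ := exists_isGaugeTransform v σ hξ1
  refine ⟨ξ, hξ1, η, y, z, hy, hz, hyz, hη, ?_, fun N hN => ?_⟩
  · have h1 := add_mem (hη 1) (neg_mem (twistedDerivative_mem_jetFil v σ hξ1))
    rw [mem_jetFil_one] at h1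
    simp only [Finset.sum_range_one, zero_add, Nat.factorial_one, Nat.cast_one, inv_one,
      one_smul, pow_zero, Module.End.one_apply, map_add, map_sub, map_neg] at h1
    change jetCoeff 0 η = jetCoeff 0 σ
    rw [← sub_eq_zero, ← h1]
    abel
  -- Compare with the gauge transform at stage `N`: the remainder `ξ - f N` has order `N + 1` and
  -- cannot affect degree `N`.
  · obtain ⟨η', -, -, -, -, -, hη'⟩ := exists_isGaugeTransform v σ (hf N).1
    have h1 : IsGaugeTransform v σ (f N + (ξ - f N)) η := by rwa [add_sub_cancel]
    have h2 := add_mem (jetFil_anti (by omega : N + 1 ≤ N + 2) (hη'.step (hf N).1 (hξf N) h1))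
      (homologicalOperator_mem_jetFil v (ev0 σ) (hξf N))
    rw [sub_add_cancel] at h2
    rw [jetProj_eq_of_sub_mem h2]
    exact (hf N).2 η' hη' N hN le_rfl

end Gauge

/-! ### Real and imaginary parts, and semisimplicity after complexification. -/

section Complexification

variable {W : Type*} [AddCommGroup W] [Module ℝ W]

variable (W) in
/-- The real part `W_ℂ → W`. -/
def rePart : ℂ ⊗[ℝ] W →ₗ[ℝ] W :=
  (TensorProduct.lid ℝ W).toLinearMap ∘ₗ LinearMap.rTensor W Complex.reLm

variable (W) in
/-- The imaginary part `W_ℂ → W`. -/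
def imPart : ℂ ⊗[ℝ] W →ₗ[ℝ] W :=
  (TensorProduct.lid ℝ W).toLinearMap ∘ₗ LinearMap.rTensor W Complex.imLm

@[simp]
theorem rePart_tmul (z : ℂ) (w : W) : rePart W (z ⊗ₜ[ℝ] w) = z.re • w := by simp [rePart]

@[simp]
theorem imPart_tmul (z : ℂ) (w : W) : imPart W (z ⊗ₜ[ℝ] w) = z.im • w := by simp [imPart]

theorem rePart_add_I_imPart (x : ℂ ⊗[ℝ] W) :
    (1 : ℂ) ⊗ₜ[ℝ] rePart W x + Complex.I ⊗ₜ[ℝ] imPart W x = x := by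
  induction x using TensorProduct.induction_on with
  | zero => simp
  | tmul z w =>
    rw [rePart_tmul, imPart_tmul, ← TensorProduct.smul_tmul, ← TensorProduct.smul_tmul,
      ← TensorProduct.add_tmul]
    congr 1
    simpa [mul_comm] using Complex.re_add_im z
  | add x y hx hy =>
    conv_rhs => rw [← hx, ← hy]
    simp only [map_add, TensorProduct.tmul_add]
    abel

theorem rePart_neg_I_smul (x : ℂ ⊗[ℝ] W) : rePart W (-Complex.I • x) = imPart W x := by
  induction x using TensorProduct.induction_on with
  | zero => simp
  | tmul z w => simp [TensorProduct.smul_tmul']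
  | add x y hx hy => rw [smul_add, map_add, map_add, hx, hy]

theorem eq_zero_of_rePart_eq_zero {x : ℂ ⊗[ℝ] W} (h : rePart W x = 0)
    (h' : rePart W (-Complex.I • x) = 0) : x = 0 := by
  rw [rePart_neg_I_smul] at h'
  rw [← rePart_add_I_imPart x, h, h', TensorProduct.tmul_zero, TensorProduct.tmul_zero, add_zero]

theorem rePart_baseChange (A : Module.End ℝ W) (x : ℂ ⊗[ℝ] W) :
    rePart W (LinearMap.baseChange ℂ A x) = A (rePart W x) := by
  induction x using TensorProduct.induction_on with
  | zero => simp
  | tmul z w => simp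
  | add x y hx hy => simp only [map_add, hx, hy]

theorem imPart_baseChange (A : Module.End ℝ W) (x : ℂ ⊗[ℝ] W) :
    imPart W (LinearMap.baseChange ℂ A x) = A (imPart W x) := by
  induction x using TensorProduct.induction_on with
  | zero => simp
  | tmul z w => simp
  | add x y hx hy => simp only [map_add, hx, hy]

theorem aeval_baseChange (A : Module.End ℝ W) (p : Polynomial ℝ) :
    Polynomial.aeval (LinearMap.baseChange ℂ A : Module.End ℂ (ℂ ⊗[ℝ] W))
      (p.map (algebraMap ℝ ℂ)) = LinearMap.baseChange ℂ (Polynomial.aeval A p) := by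
  rw [Polynomial.aeval_map_algebraMap]
  exact Polynomial.aeval_algHom_apply (Module.End.baseChangeHom ℝ ℂ W) A p

/-- Over the perfect field `ℝ` a squarefree minimal polynomial is separable, and separability,
unlike squarefreeness in general, is stable under field extension. -/
theorem isSemisimple_baseChange [FiniteDimensional ℝ W] {A : Module.End ℝ W}
    (hA : A.IsSemisimple) :
    Module.End.IsSemisimple (LinearMap.baseChange ℂ A : Module.End ℂ (ℂ ⊗[ℝ] W)) := by
  have h1 : ((minpoly ℝ A).map (algebraMap ℝ ℂ)).Separable :=
    (PerfectField.separable_iff_squarefree.2 hA.minpoly_squarefree).map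
  refine Module.End.isSemisimple_of_squarefree_aeval_eq_zero h1.squarefree ?_
  rw [aeval_baseChange, minpoly.aeval, LinearMap.baseChange_zero]

end Complexification

/-! ### Compact Lie algebras: semisimple adjoint operators and root vectors. -/

section Compact

variable {k : Type*} [LieRing k] [LieAlgebra ℝ k]

/-- By invariance of the Killing form, the orthogonal complement of an invariant subspace is
invariant; by definiteness it is a complement. -/
theorem IsCompactSimple.isSemisimple_ad (hk : IsCompactSimple k) (X : k) :
    (LieAlgebra.ad ℝ k X).IsSemisimple := by
  have := hk.finite
  rw [Module.End.isSemisimple_iff]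
  intro p hp
  have hneg : ∀ Y : k, killingForm ℝ k Y Y = 0 → Y = 0 := fun Y hY => by
    by_contra h
    exact (hk.negDef Y h).ne hY
  have hrefl : LinearMap.BilinForm.IsRefl (killingForm ℝ k) :=
    (LieModule.traceForm_isSymm ℝ k k).isRefl
  refine ⟨LinearMap.BilinForm.orthogonal (killingForm ℝ k) p, ?_, ?_⟩
  · rw [Module.End.mem_invtSubmodule] at hp ⊢
    intro Y hY Z hZ
    have h1 := hY _ (hp hZ)
    simp only [LieAlgebra.ad_apply] at h1 ⊢
    rw [← LieModule.traceForm_apply_lie_apply, ← lie_skew, map_neg, LinearMap.neg_apply]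
    simpa using h1
  · rw [LinearMap.BilinForm.isCompl_orthogonal_iff_disjoint hrefl, Submodule.disjoint_def]
    intro Y hY hY'
    exact hneg Y (hY' Y hY)

theorem baseChange_ad_apply (X : k) (x : ℂ ⊗[ℝ] k) :
    LinearMap.baseChange ℂ (LieAlgebra.ad ℝ k X) x = ⁅((1 : ℂ) ⊗ₜ[ℝ] X : ℂ ⊗[ℝ] k), x⁆ := by
  have : LinearMap.baseChange ℂ (LieAlgebra.ad ℝ k X) =
      LieAlgebra.ad ℂ (ℂ ⊗[ℝ] k) ((1 : ℂ) ⊗ₜ[ℝ] X) := by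
    refine TensorProduct.AlgebraTensorModule.curry_injective ?_
    ext Y
    simp
  rw [this]
  rfl

theorem IsMaximalTorus.lie_eq_zero {t : LieSubalgebra ℝ k} (ht : IsMaximalTorus t) {X Y : k}
    (hX : X ∈ t) (hY : Y ∈ t) : ⁅X, Y⁆ = 0 := by
  have : IsLieAbelian t := ht.prop
  have := congrArg Subtype.val (trivial_lie_zero t t ⟨X, hX⟩ ⟨Y, hY⟩)
  simpa using this

/-- If `X` centralizes `𝔱`, then `𝔱 + ℝX` is an abelian subalgebra, so maximality absorbs `X`. -/
theorem IsMaximalTorus.mem_of_forall_lie_eq_zero {t : LieSubalgebra ℝ k} (ht : IsMaximalTorus t)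
    {X : k} (hX : ∀ H ∈ t, ⁅H, X⁆ = 0) : X ∈ t := by
  have key : ∀ Y ∈ t.toSubmodule ⊔ Submodule.span ℝ {X},
      ∀ Z ∈ t.toSubmodule ⊔ Submodule.span ℝ {X}, ⁅Y, Z⁆ = 0 := by
    intro Y hY Z hZ
    obtain ⟨H, hH, Y', hY', rfl⟩ := Submodule.mem_sup.1 hY
    obtain ⟨K, hK, Z', hZ', rfl⟩ := Submodule.mem_sup.1 hZ
    obtain ⟨a, rfl⟩ := Submodule.mem_span_singleton.1 hY'
    obtain ⟨c, rfl⟩ := Submodule.mem_span_singleton.1 hZ'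
    have h1 : ⁅X, K⁆ = 0 := by rw [← lie_skew, hX K hK, neg_zero]
    simp [ht.lie_eq_zero hH hK, hX H hH, h1]
  let s : LieSubalgebra ℝ k :=
    { t.toSubmodule ⊔ Submodule.span ℝ {X} with
      lie_mem' := fun {Y Z} hY hZ => by
        rw [key Y hY Z hZ]; exact zero_mem (t.toSubmodule ⊔ Submodule.span ℝ {X}) }
  have hs : IsLieAbelian s := ⟨fun Y Z => Subtype.ext (key Y Y.2 Z Z.2)⟩
  have hts : t ≤ s := fun Y hY => Submodule.mem_sup_left (S := t.toSubmodule) hY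
  exact ht.le_of_ge hs hts
    (Submodule.mem_sup_right (S := t.toSubmodule) (Submodule.mem_span_singleton_self X))

/-- `𝔨_ℂ` is spanned by `𝔱_ℂ` and the root vectors. -/
theorem span_rootVectors_eq_top (hk : IsCompactSimple k) {t : LieSubalgebra ℝ k}
    (ht : IsMaximalTorus t) :
    Submodule.span ℂ ({x : ℂ ⊗[ℝ] k | ∃ α : t →ₗ[ℝ] ℂ, IsRoot t α ∧ ∀ H : t,
        LinearMap.baseChange ℂ (LieAlgebra.ad ℝ k (H : k)) x = α H • x} ∪
      {x | ∃ z : ℂ, ∃ H ∈ t, x = z ⊗ₜ[ℝ] H}) = ⊤ := by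
  have := hk.finite
  have hsemi : ∀ H : t,
      Module.End.IsFinitelySemisimple (LinearMap.baseChange ℂ (LieAlgebra.ad ℝ k (H : k))) := fun H =>
    Module.End.isFinitelySemisimple_iff_isSemisimple.2
      (isSemisimple_baseChange (hk.isSemisimple_ad H))
  have h1 := Module.End.iSup_iInf_maxGenEigenspace_eq_top_of_iSup_maxGenEigenspace_eq_top_of_commute
    (fun H : t => (LinearMap.baseChange ℂ (LieAlgebra.ad ℝ k (H : k)) :
      Module.End ℂ (ℂ ⊗[ℝ] k))) ?_ (fun H => Module.End.iSup_maxGenEigenspace_eq_top _)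
  · rw [eq_top_iff, ← h1]
    refine iSup_le fun χ x hx => ?_
    simp only [(hsemi _).maxGenEigenspace_eq_eigenspace, Submodule.mem_iInf,
      Module.End.mem_eigenspace_iff] at hx
    by_cases hx0 : x = 0
    · rw [hx0]; exact zero_mem _
    have hinj : ∀ a c : ℂ, a • x = c • x → a = c := fun a c h => smul_left_injective ℂ hx0 h
    -- A joint eigenvalue is at first only a function on `𝔱`; a nonzero joint eigenvector forces it
    -- to be linear.
    let α : t →ₗ[ℝ] ℂ :=
      { toFun := χ
        map_add' := fun H K => hinj _ _ <| by
          rw [add_smul, ← hx, ← hx, ← hx, show ((H + K : t) : k) = H + K from rfl, map_add,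
            LinearMap.baseChange_add, LinearMap.add_apply]
        map_smul' := fun c H => hinj _ _ <| by
          rw [RingHom.id_apply, smul_assoc, ← hx, ← hx, show ((c • H : t) : k) = c • (H : k) from rfl, map_smul,
            LinearMap.baseChange_smul, LinearMap.smul_apply] }
    by_cases hα : α = 0
    · have h0 : ∀ H : t, LinearMap.baseChange ℂ (LieAlgebra.ad ℝ k (H : k)) x = 0 := fun H => by
        rw [hx H]
        change α H • x = 0
        rw [hα, LinearMap.zero_apply, zero_smul]
      -- Zero weight: real and imaginary parts of `x` both centralize `𝔱`, hence lie in `𝔱`.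
      rw [← rePart_add_I_imPart x]
      refine add_mem (Submodule.subset_span (Or.inr ⟨_, _, ?_, rfl⟩))
        (Submodule.subset_span (Or.inr ⟨_, _, ?_, rfl⟩))
      · refine ht.mem_of_forall_lie_eq_zero fun H hH => ?_
        rw [← LieAlgebra.ad_apply (R := ℝ), ← rePart_baseChange, h0 ⟨H, hH⟩, map_zero]
      · refine ht.mem_of_forall_lie_eq_zero fun H hH => ?_
        rw [← LieAlgebra.ad_apply (R := ℝ), ← imPart_baseChange, h0 ⟨H, hH⟩, map_zero]
    · refine Submodule.subset_span (Or.inl ⟨α, ⟨hα, x, hx0, fun H => ?_⟩, hx⟩)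
      rw [← baseChange_ad_apply]
      exact hx H
  · intro H K _
    have h2 : LieAlgebra.ad ℝ k (H : k) ∘ₗ LieAlgebra.ad ℝ k (K : k) =
        LieAlgebra.ad ℝ k (K : k) ∘ₗ LieAlgebra.ad ℝ k (H : k) := by
      ext Y
      simp [leibniz_lie (H : k) (K : k) Y, ht.lie_eq_zero H.2 K.2]
    change _ ∘ₗ _ = _ ∘ₗ _
    rw [← LinearMap.baseChange_comp, h2, LinearMap.baseChange_comp]

theorem span_eigenvectors_ad_eq_top (hk : IsCompactSimple k) (X : k) :
    Submodule.span ℂ {x : ℂ ⊗[ℝ] k | ∃ c : ℂ,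
      LinearMap.baseChange ℂ (LieAlgebra.ad ℝ k X) x = c • x} = ⊤ := by
  have := hk.finite
  rw [eq_top_iff, ← (isSemisimple_baseChange (hk.isSemisimple_ad X)).iSup_eigenspace_eq_top]
  exact iSup_le fun c x hx => Submodule.subset_span ⟨c, Module.End.mem_eigenspace_iff.1 hx⟩

end Compact

/-! ### Spectral theory of a linear vector field on homogeneous polynomials. -/

section LinearDerivation

variable {d : ℕ}

/-- Reduces spanning statements to linear forms. It is applied with `T` consisting of homogeneous
eigenvectors or generalized eigenvectors of the derivation, which are closed under products by the
Leibniz rule. -/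
theorem mem_span_of_isHomogeneous (T : ℕ → Set (MvPolynomial (Fin d) ℂ)) (h0 : 1 ∈ T 0)
    (h1 : ∀ i, MvPolynomial.X i ∈ Submodule.span ℂ (T 1))
    (hmul : ∀ M N f g, f ∈ T M → g ∈ T N → f * g ∈ T (M + N)) {N : ℕ}
    {f : MvPolynomial (Fin d) ℂ} (hf : f.IsHomogeneous N) : f ∈ Submodule.span ℂ (T N) := by
  have hmul' : ∀ M N f g, f ∈ Submodule.span ℂ (T M) → g ∈ Submodule.span ℂ (T N) →
      f * g ∈ Submodule.span ℂ (T (M + N)) := by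
    intro M N f g hf hg
    have h := Submodule.mul_mem_mul hf hg
    rw [Submodule.span_mul_span] at h
    refine Submodule.span_mono ?_ h
    rintro _ ⟨a, ha, c, hc, rfl⟩
    exact hmul _ _ _ _ ha hc
  have hmono : ∀ n : Fin d →₀ ℕ,
      MvPolynomial.monomial n (1 : ℂ) ∈ Submodule.span ℂ (T n.degree) := by
    intro n
    induction n using Finsupp.induction_linear with
    | zero => simpa using Submodule.subset_span h0
    | add a c ha hc =>
      have := hmul' _ _ _ _ ha hc
      rwa [MvPolynomial.monomial_mul, one_mul, ← map_add] at this
    | single i m =>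
      rw [Finsupp.degree_single, ← MvPolynomial.X_pow_eq_monomial]
      induction m with
      | zero => simpa using Submodule.subset_span h0
      | succ m ih => rw [pow_succ]; exact hmul' _ _ _ _ ih (h1 i)
  rw [f.as_sum]
  refine sum_mem fun n hn => ?_
  have hdeg : n.degree = N := by
    have := hf (MvPolynomial.mem_support_iff.1 hn)
    rwa [show (1 : Fin d → ℕ) = fun _ => 1 from rfl, ← Finsupp.degree_eq_weight_one] at this
  rw [← hdeg, show MvPolynomial.monomial n (MvPolynomial.coeff n f) =
    MvPolynomial.coeff n f • MvPolynomial.monomial n (1 : ℂ) by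
      rw [MvPolynomial.smul_monomial, smul_eq_mul, mul_one]]
  exact Submodule.smul_mem _ _ (hmono n)

/-- The Lie derivative of the linear vector field with matrix `M` on complex polynomials. -/
def linearDerivation (M : Matrix (Fin d) (Fin d) ℂ) :
    Derivation ℂ (MvPolynomial (Fin d) ℂ) (MvPolynomial (Fin d) ℂ) :=
  MvPolynomial.mkDerivation ℂ fun i => ∑ j, M i j • MvPolynomial.X j

theorem linearDerivation_apply (M : Matrix (Fin d) (Fin d) ℂ) (f : MvPolynomial (Fin d) ℂ) :
    linearDerivation M f = ∑ i, (∑ j, M i j • MvPolynomial.X j) * MvPolynomial.pderiv i f := by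
  have : linearDerivation M =
      ∑ i, (∑ j, M i j • MvPolynomial.X j : MvPolynomial (Fin d) ℂ) • MvPolynomial.pderiv i := by
    refine MvPolynomial.derivation_ext fun i => ?_
    rw [linearDerivation, MvPolynomial.mkDerivation_X, ← Derivation.coeFnAddMonoidHom_apply,
      map_sum, Finset.sum_apply]
    symm
    refine (Finset.sum_eq_single i (fun j _ hj => ?_) (by simp)).trans ?_
    · change (∑ l, M j l • MvPolynomial.X l : MvPolynomial (Fin d) ℂ) •
        MvPolynomial.pderiv j (MvPolynomial.X i : MvPolynomial (Fin d) ℂ) = 0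
      rw [MvPolynomial.pderiv_X_of_ne hj.symm, smul_zero]
    · change (∑ l, M i l • MvPolynomial.X l : MvPolynomial (Fin d) ℂ) •
        MvPolynomial.pderiv i (MvPolynomial.X i : MvPolynomial (Fin d) ℂ) = _
      rw [MvPolynomial.pderiv_X_self, smul_eq_mul, mul_one]
  rw [this, ← Derivation.coeFnAddMonoidHom_apply, map_sum, Finset.sum_apply]
  simp

theorem linearDerivation_isHomogeneous (M : Matrix (Fin d) (Fin d) ℂ) {N : ℕ}
    {f : MvPolynomial (Fin d) ℂ} (hf : f.IsHomogeneous N) :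
    (linearDerivation M f).IsHomogeneous N := by
  have hX : ∀ i, (∑ j, M i j • MvPolynomial.X j : MvPolynomial (Fin d) ℂ).IsHomogeneous 1 :=
    fun i => Submodule.sum_mem (MvPolynomial.homogeneousSubmodule (Fin d) ℂ 1) fun j _ =>
      Submodule.smul_mem _ _ (MvPolynomial.isHomogeneous_X ℂ j)
  rcases Nat.eq_zero_or_pos N with rfl | hN
  · rw [MvPolynomial.totalDegree_eq_zero_iff_eq_C.1
      ((MvPolynomial.totalDegree_zero_iff_isHomogeneous _).2 hf), ← MvPolynomial.algebraMap_eq,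
      Derivation.map_algebraMap]
    exact MvPolynomial.isHomogeneous_zero _ _ _
  · rw [linearDerivation_apply]
    refine Submodule.sum_mem (MvPolynomial.homogeneousSubmodule (Fin d) ℂ N) fun i _ => ?_
    have := (hX i).mul (hf.pderiv (i := i))
    rwa [Nat.add_sub_cancel' hN] at this

/-- By Leibniz, `(L - a - c)(fg) = ((L - a)f) g + f ((L - c)g)`; each application uses up one of the
`p + q` available powers. -/
theorem mul_mem_maxGenEigenspace {A : Type*} [CommRing A] [Algebra ℂ A]
    (L : Module.End ℂ A) (hL : ∀ f g, L (f * g) = L f * g + f * L g) {a c : ℂ} {f g : A}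
    (hf : f ∈ L.maxGenEigenspace a) (hg : g ∈ L.maxGenEigenspace c) :
    f * g ∈ L.maxGenEigenspace (a + c) := by
  rw [Module.End.mem_maxGenEigenspace] at hf hg ⊢
  obtain ⟨p, hp⟩ := hf
  obtain ⟨q, hq⟩ := hg
  refine ⟨p + q, ?_⟩
  have key : ∀ m p q, p + q = m → ∀ f g : A,
      ((L - a • (1 : Module.End ℂ A)) ^ p) f = 0 → ((L - c • (1 : Module.End ℂ A)) ^ q) g = 0 →
      ((L - (a + c) • (1 : Module.End ℂ A)) ^ m) (f * g) = 0 := by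
    intro m
    induction m with
    | zero =>
      intro p q h f g hf hg
      obtain ⟨rfl, rfl⟩ : p = 0 ∧ q = 0 := by omega
      simp only [pow_zero, Module.End.one_apply] at hf
      simp [hf]
    | succ m ih =>
      intro p q h f g hf hg
      have e : (L - (a + c) • (1 : Module.End ℂ A)) (f * g) =
          (L - a • (1 : Module.End ℂ A)) f * g + f * (L - c • (1 : Module.End ℂ A)) g := by
        simp only [LinearMap.sub_apply, LinearMap.smul_apply, Module.End.one_apply, hL]
        simp only [Algebra.smul_def, map_add]
        ring
      rw [pow_succ, Module.End.mul_apply, e, map_add]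
      have h1 : ((L - (a + c) • (1 : Module.End ℂ A)) ^ m)
          ((L - a • (1 : Module.End ℂ A)) f * g) = 0 := by
        rcases p with _ | p
        · simp only [pow_zero, Module.End.one_apply] at hf
          simp [hf]
        · exact ih p q (by omega) _ _ (by rwa [pow_succ, Module.End.mul_apply] at hf) hg
      have h2 : ((L - (a + c) • (1 : Module.End ℂ A)) ^ m)
          (f * (L - c • (1 : Module.End ℂ A)) g) = 0 := by
        rcases q with _ | q
        · simp only [pow_zero, Module.End.one_apply] at hg
          simp [hg]
        · exact ih p q (by omega) _ _ hf (by rwa [pow_succ, Module.End.mul_apply] at hg)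
      rw [h1, h2, add_zero]
  exact key _ p q rfl f g hp hq

variable {V : Type*} [AddCommGroup V] [Module ℝ V]

/-- A linear form on `V_ℂ` as a linear polynomial. -/
def linearForm (b : Module.Basis (Fin d) ℝ V) :
    Module.Dual ℂ (ℂ ⊗[ℝ] V) →ₗ[ℂ] MvPolynomial (Fin d) ℂ where
  toFun l := ∑ i, l ((1 : ℂ) ⊗ₜ[ℝ] b i) • MvPolynomial.X i
  map_add' l l' := by simp [add_smul, Finset.sum_add_distrib]
  map_smul' c l := by simp [mul_smul, Finset.smul_sum]

theorem linearForm_isHomogeneous (b : Module.Basis (Fin d) ℝ V)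
    (l : Module.Dual ℂ (ℂ ⊗[ℝ] V)) : (linearForm b l).IsHomogeneous 1 :=
  Submodule.sum_mem (MvPolynomial.homogeneousSubmodule (Fin d) ℂ 1) fun j _ =>
      Submodule.smul_mem _ _ (MvPolynomial.isHomogeneous_X ℂ j)

theorem linearForm_injective (b : Module.Basis (Fin d) ℝ V) :
    Function.Injective (linearForm b) := by
  rw [← LinearMap.ker_eq_bot, LinearMap.ker_eq_bot']
  intro l hl
  refine (b.baseChange ℂ).ext fun i => ?_
  have := congrArg (MvPolynomial.coeff (Finsupp.single i 1)) hl
  classical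
  simpa [linearForm, MvPolynomial.coeff_sum, MvPolynomial.coeff_X,
    Finsupp.single_left_inj] using this

theorem X_mem_range_linearForm (b : Module.Basis (Fin d) ℝ V) (i : Fin d) :
    linearForm b ((b.baseChange ℂ).coord i) = MvPolynomial.X i := by
  classical
  have : ∀ j, (1 : ℂ) ⊗ₜ[ℝ] b j = b.baseChange ℂ j := fun j => by simp
  simp only [linearForm, LinearMap.coe_mk, AddHom.coe_mk, this, Module.Basis.coord_apply,
    Module.Basis.repr_self]
  rw [Finset.sum_eq_single i]
  · simp
  · intro j _ hj
    simp [hj]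
  · simp

/-- The matrix of the linearization, with complex entries. -/
def FormalVectorField.complexMatrix (v : FormalVectorField d) : Matrix (Fin d) (Fin d) ℂ :=
  Matrix.of fun i j => ((MvPowerSeries.coeff (Finsupp.single j 1) (v.comp i) : ℝ) : ℂ)

/-- On linear functions the Lie derivative is the transpose of `v_l`, with no sign; hence the
eigenvalues on polynomials are `⟨n, μ⟩` rather than their negatives. -/
theorem linearDerivation_linearForm (b : Module.Basis (Fin d) ℝ V) (v : FormalVectorField d)
    (l : Module.Dual ℂ (ℂ ⊗[ℝ] V)) :
    linearDerivation v.complexMatrix (linearForm b l) =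
      linearForm b (l ∘ₗ LinearMap.baseChange ℂ (v.linearization b)) := by
  simp only [linearForm, LinearMap.coe_mk, AddHom.coe_mk, map_sum, Derivation.map_smul,
    linearDerivation, MvPolynomial.mkDerivation_X, LinearMap.comp_apply,
    LinearMap.baseChange_tmul, FormalVectorField.linearization, Matrix.toLin_self,
    TensorProduct.tmul_sum, Finset.smul_sum, Finset.sum_smul]
  rw [Finset.sum_comm]
  refine Finset.sum_congr rfl fun j _ => Finset.sum_congr rfl fun i _ => ?_
  have h : ∀ (r : ℝ) (x : ℂ ⊗[ℝ] V), l (r • x) = (r : ℂ) * l x := fun r x => by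
    rw [← algebraMap_smul ℂ r x, map_smul, smul_eq_mul, Complex.coe_algebraMap]
  rw [smul_smul, TensorProduct.tmul_smul, h, mul_comm]
  rfl

/-- The action of the linear vector field on complex homogeneous polynomials, as an operator. -/
abbrev linearOperator (M : Matrix (Fin d) (Fin d) ℂ) : Module.End ℂ (MvPolynomial (Fin d) ℂ) :=
  (linearDerivation M : MvPolynomial (Fin d) ℂ →ₗ[ℂ] MvPolynomial (Fin d) ℂ)

theorem linearOperator_mul (M : Matrix (Fin d) (Fin d) ℂ) (f g : MvPolynomial (Fin d) ℂ) :
    linearOperator M (f * g) = linearOperator M f * g + f * linearOperator M g := by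
  simp only [Derivation.coeFn_coe, Derivation.leibniz, smul_eq_mul]
  ring

theorem X_mem_span_linearForm (b : Module.Basis (Fin d) ℝ V)
    (e : Module.Basis (Fin d) ℂ (ℂ ⊗[ℝ] V)) (i : Fin d) :
    MvPolynomial.X i ∈ Submodule.span ℂ (Set.range fun j => linearForm b (e.coord j)) := by
  have h : (b.baseChange ℂ).coord i = ∑ j, (b.baseChange ℂ).coord i (e j) • e.coord j := by
    refine e.ext fun m => ?_
    rw [LinearMap.sum_apply, Finset.sum_eq_single m]
    · simp
    · intro j _ hj
      simp [hj.symm]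
    · simp
  rw [← X_mem_range_linearForm b i, h, map_sum]
  refine sum_mem fun j _ => ?_
  rw [map_smul]
  exact Submodule.smul_mem _ _ (Submodule.subset_span ⟨j, rfl⟩)

theorem comp_eq_smul_coord {e : Module.Basis (Fin d) ℂ (ℂ ⊗[ℝ] V)}
    {s : Module.End ℂ (ℂ ⊗[ℝ] V)} {μ : Fin d → ℂ} (hs : ∀ j, s (e j) = μ j • e j) (j : Fin d) :
    e.coord j ∘ₗ s = μ j • e.coord j := by
  refine e.ext fun m => ?_
  rw [LinearMap.comp_apply, hs, map_smul, LinearMap.smul_apply]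
  rcases eq_or_ne m j with rfl | h
  · rfl
  · simp [h]

theorem linearForm_mem_maxGenEigenspace (b : Module.Basis (Fin d) ℝ V) (v : FormalVectorField d)
    {s n : Module.End ℂ (ℂ ⊗[ℝ] V)}
    (hsn : LinearMap.baseChange ℂ (v.linearization b) = s + n) (hcomm : Commute s n)
    (hn : IsNilpotent n) {l : Module.Dual ℂ (ℂ ⊗[ℝ] V)} {c : ℂ} (hl : l ∘ₗ s = c • l) :
    linearForm b l ∈ (linearOperator v.complexMatrix).maxGenEigenspace c := by
  obtain ⟨p, hp⟩ := hn
  rw [Module.End.mem_maxGenEigenspace]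
  -- The semisimple part contributes exactly `c`, so `L - c` acts on these forms as the transpose of
  -- the nilpotent part.
  have key : ∀ q, ((linearOperator v.complexMatrix - c • (1 : Module.End ℂ (MvPolynomial (Fin d) ℂ))) ^ q)
      (linearForm b l) = linearForm b (l ∘ₗ (n ^ q)) := by
    intro q
    induction q with
    | zero => rfl
    | succ q ih =>
      have h1 : l ∘ₗ (n ^ q) ∘ₗ s = c • l ∘ₗ (n ^ q) := by
        have h2 : (n ^ q) ∘ₗ s = s ∘ₗ (n ^ q) := ((hcomm.pow_right q).eq).symm
        rw [h2, ← LinearMap.comp_assoc, hl, LinearMap.smul_comp]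
      rw [pow_succ', Module.End.mul_apply, ih, LinearMap.sub_apply, LinearMap.smul_apply,
        Module.End.one_apply, Derivation.coeFn_coe, linearDerivation_linearForm, hsn, ← map_smul,
        ← map_sub]
      congr 1
      rw [LinearMap.comp_add, LinearMap.comp_assoc, h1, add_sub_cancel_left, pow_succ,
        LinearMap.comp_assoc, Module.End.mul_eq_comp]
  refine ⟨p, ?_⟩
  rw [key, hp, LinearMap.comp_zero, map_zero]

/-- Here `L - c` is the nonzero scalar `a - c` plus the locally nilpotent `L - a`; it is inverted by
induction on the nilpotency order, staying inside the invariant subspace `U`. -/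
theorem exists_sub_smul_eq_of_mem_maxGenEigenspace {A : Type*} [AddCommGroup A] [Module ℂ A]
    (L : Module.End ℂ A) (U : Submodule ℂ A) (hU : ∀ f ∈ U, L f ∈ U) {a c : ℂ} (hac : a ≠ c)
    {f : A} (hfU : f ∈ U) (hf : f ∈ L.maxGenEigenspace a) : ∃ g ∈ U, L g - c • g = f := by
  rw [Module.End.mem_maxGenEigenspace] at hf
  obtain ⟨p, hp⟩ := hf
  induction p generalizing f with
  | zero => exact ⟨0, zero_mem _, by simpa using hp.symm⟩
  | succ p ih =>
    rw [pow_succ, Module.End.mul_apply] at hp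
    obtain ⟨g, hg, hg'⟩ := ih (f := (L - a • (1 : Module.End ℂ A)) f)
      (sub_mem (hU f hfU) (U.smul_mem a hfU)) hp
    refine ⟨(a - c)⁻¹ • (f - g), U.smul_mem _ (sub_mem hfU hg), ?_⟩
    have h1 : L f - a • f = L g - c • g := hg'.symm
    have h2 : L (f - g) - c • (f - g) = (a - c) • f := by
      have h3 : L f = L g - c • g + a • f := by rw [← h1, sub_add_cancel]
      rw [map_sub, smul_sub, sub_smul, h3]
      abel
    rw [map_smul, smul_comm c, ← smul_sub, h2, smul_smul, inv_mul_cancel₀ (sub_ne_zero.2 hac),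
      one_smul]

/-- Away from the numbers `⟨n, μ⟩` with `|n| = N`, the shifted operator `L - c` is surjective on
homogeneous polynomials of degree `N`. -/
theorem exists_linearDerivation_sub_smul_eq (b : Module.Basis (Fin d) ℝ V)
    (v : FormalVectorField d) {μ : Fin d → ℂ} (hμ : IsEigenvalueFamily (v.linearization b) μ)
    {N : ℕ} {c : ℂ} (hc : ∀ n : Fin d → ℕ, ∑ i, n i = N → ∑ i, (n i : ℂ) * μ i ≠ c)
    {f : MvPolynomial (Fin d) ℂ} (hf : f.IsHomogeneous N) :
    ∃ g : MvPolynomial (Fin d) ℂ, g.IsHomogeneous N ∧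
      linearDerivation v.complexMatrix g - c • g = f := by
  obtain ⟨s, n, e, hsn, hcomm, hn, hs⟩ := hμ
  let T : ℕ → Set (MvPolynomial (Fin d) ℂ) := fun N => {f | f.IsHomogeneous N ∧
    ∃ n : Fin d → ℕ, ∑ i, n i = N ∧
      f ∈ (linearOperator v.complexMatrix).maxGenEigenspace (∑ i, (n i : ℂ) * μ i)}
  have hT : f ∈ Submodule.span ℂ (T N) := by
    refine mem_span_of_isHomogeneous T ?_ ?_ ?_ hf
    · refine ⟨MvPolynomial.isHomogeneous_one _ _, 0, by simp, ?_⟩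
      rw [Module.End.mem_maxGenEigenspace]
      exact ⟨1, by simp⟩
    · intro i
      refine Submodule.span_mono ?_ (X_mem_span_linearForm b e i)
      rintro _ ⟨j, rfl⟩
      refine ⟨linearForm_isHomogeneous b _, Pi.single j 1, by simp, ?_⟩
      have : ∑ i, ((Pi.single j 1 : Fin d → ℕ) i : ℂ) * μ i = μ j := by
        rw [Finset.sum_eq_single j]
        · simp
        · intro i _ hi
          simp [hi]
        · simp
      rw [this]
      exact linearForm_mem_maxGenEigenspace b v hsn hcomm hn (comp_eq_smul_coord hs j)
    · rintro M N f g ⟨hf, m, hm, hf'⟩ ⟨hg, n, hn, hg'⟩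
      refine ⟨hf.mul hg, m + n, by simp [Finset.sum_add_distrib, hm, hn], ?_⟩
      have := mul_mem_maxGenEigenspace _ (linearOperator_mul v.complexMatrix) hf' hg'
      rw [← Finset.sum_add_distrib] at this
      simpa only [Pi.add_apply, Nat.cast_add, add_mul] using this
  have h1 : ∃ g ∈ MvPolynomial.homogeneousSubmodule (Fin d) ℂ N,
      linearOperator v.complexMatrix g - c • g = f := by
    clear hf
    induction hT using Submodule.span_induction with
    | mem f hf =>
      obtain ⟨hf, n, hn, hf'⟩ := hf
      exact exists_sub_smul_eq_of_mem_maxGenEigenspace _ _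
        (fun g hg => linearDerivation_isHomogeneous _ hg) (hc n hn) hf hf'
    | zero => exact ⟨0, zero_mem _, by simp⟩
    | add f f' _ _ h h' =>
      obtain ⟨g, hg, rfl⟩ := h
      obtain ⟨g', hg', rfl⟩ := h'
      exact ⟨g + g', add_mem hg hg', by rw [map_add, smul_add]; abel⟩
    | smul a f _ h =>
      obtain ⟨g, hg, rfl⟩ := h
      exact ⟨a • g, Submodule.smul_mem _ _ hg, by rw [map_smul, smul_sub, smul_comm c]⟩
  exact h1

theorem exists_eigenbasis {W : Type*} [AddCommGroup W] [Module ℂ W]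
    (b : Module.Basis (Fin d) ℂ W) {A : Module.End ℂ W} (hA : A.IsSemisimple) :
    ∃ (e : Module.Basis (Fin d) ℂ W) (μ : Fin d → ℂ), ∀ j, A (e j) = μ j • e j := by
  have : FiniteDimensional ℂ W := b.finiteDimensional_of_finite
  have hspan : ⊤ ≤ Submodule.span ℂ {x : W | ∃ c : ℂ, A x = c • x} := by
    rw [← hA.iSup_eigenspace_eq_top]
    exact iSup_le fun c x hx => Submodule.subset_span ⟨c, Module.End.mem_eigenspace_iff.1 hx⟩
  let e₀ := Module.Basis.ofSpan hspan
  let e := e₀.reindex (e₀.indexEquiv b)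
  have he : ∀ j, ∃ c : ℂ, A (e j) = c • e j := fun j => by
    rw [Module.Basis.reindex_apply]
    exact Module.Basis.ofSpan_subset hspan ⟨_, rfl⟩
  choose μ hμ using he
  exact ⟨e, μ, hμ⟩

/-- For semisimple linearization, the homogeneous polynomials of degree `N` are spanned by the
kernel and the range of every shifted operator `L - c`. -/
theorem exists_add_linearDerivation_sub_smul_eq (b : Module.Basis (Fin d) ℝ V)
    (v : FormalVectorField d) (hv : (v.linearization b).IsSemisimple) {N : ℕ} (c : ℂ)
    {f : MvPolynomial (Fin d) ℂ} (hf : f.IsHomogeneous N) :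
    ∃ h g : MvPolynomial (Fin d) ℂ, g.IsHomogeneous N ∧
      linearDerivation v.complexMatrix h = c • h ∧
      h + (linearDerivation v.complexMatrix g - c • g) = f := by
  have : FiniteDimensional ℝ V := b.finiteDimensional_of_finite
  obtain ⟨e, μ, he⟩ := exists_eigenbasis (b.baseChange ℂ) (isSemisimple_baseChange hv)
  let T : ℕ → Set (MvPolynomial (Fin d) ℂ) := fun N => {f | f.IsHomogeneous N ∧
    ∃ a : ℂ, linearDerivation v.complexMatrix f = a • f}
  have hT : f ∈ Submodule.span ℂ (T N) := by
    refine mem_span_of_isHomogeneous T ⟨MvPolynomial.isHomogeneous_one _ _, 0, by simp⟩ ?_ ?_ hf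
    · intro i
      refine Submodule.span_mono ?_ (X_mem_span_linearForm b e i)
      rintro _ ⟨j, rfl⟩
      refine ⟨linearForm_isHomogeneous b _, μ j, ?_⟩
      rw [linearDerivation_linearForm, comp_eq_smul_coord he, map_smul]
    · rintro M N f g ⟨hf, a, ha⟩ ⟨hg, a', ha'⟩
      refine ⟨hf.mul hg, a + a', ?_⟩
      rw [Derivation.leibniz, ha, ha', smul_eq_mul, smul_eq_mul, mul_smul_comm, mul_smul_comm,
        mul_comm g, ← add_smul, add_comm]
  clear hf
  induction hT using Submodule.span_induction with
  | mem f hf =>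
    obtain ⟨hf, a, ha⟩ := hf
    -- An eigenvector is either in the kernel of `L - c` or a multiple of its own image.
    by_cases hac : a = c
    · exact ⟨f, 0, MvPolynomial.isHomogeneous_zero _ _ _, hac ▸ ha, by simp⟩
    · refine ⟨0, (a - c)⁻¹ • f, ?_, by simp, ?_⟩
      · exact (MvPolynomial.homogeneousSubmodule (Fin d) ℂ N).smul_mem _ hf
      · rw [Derivation.map_smul, ha, smul_comm c, ← smul_sub, ← sub_smul, smul_smul,
          inv_mul_cancel₀ (sub_ne_zero.2 hac), one_smul, zero_add]
  | zero => exact ⟨0, 0, MvPolynomial.isHomogeneous_zero _ _ _, by simp, by simp⟩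
  | add f f' _ _ h h' =>
    obtain ⟨h, g, hg, hh, rfl⟩ := h
    obtain ⟨h', g', hg', hh', rfl⟩ := h'
    refine ⟨h + h', g + g', hg.add hg', by rw [map_add, hh, hh', smul_add], ?_⟩
    rw [map_add, smul_add]
    abel
  | smul a f _ h =>
    obtain ⟨h, g, hg, hh, rfl⟩ := h
    refine ⟨a • h, a • g, (MvPolynomial.homogeneousSubmodule (Fin d) ℂ N).smul_mem _ hg, ?_, ?_⟩
    · rw [Derivation.map_smul, hh, smul_comm]
    · rw [Derivation.map_smul, smul_comm c, smul_add, smul_sub]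

end LinearDerivation

/-! ### Real jets as real parts of complex tensors; the homological equation. -/

section ComplexJets

variable {d : ℕ} {k : Type*} [LieRing k] [LieAlgebra ℝ k]

/-- The real part of a complex polynomial, as a formal power series. -/
def reSeries : MvPolynomial (Fin d) ℂ →ₗ[ℝ] FormalSeries d where
  toFun f n := (MvPolynomial.coeff n f).re
  map_add' f g := funext fun n => by simp; rfl
  map_smul' c f := funext fun n => by simp; rfl

@[simp]
theorem coeff_reSeries (n : Fin d →₀ ℕ) (f : MvPolynomial (Fin d) ℂ) :
    MvPowerSeries.coeff n (reSeries f) = (MvPolynomial.coeff n f).re := rfl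

variable (d k) in
/-- The real part of `f ⊗ x`, for a complex polynomial `f` and `x ∈ 𝔨_ℂ`. -/
def reJet : MvPolynomial (Fin d) ℂ →ₗ[ℝ] ℂ ⊗[ℝ] k →ₗ[ℝ] JetAlgebra d k :=
  LinearMap.rTensorHom k ∘ₗ LinearMap.mk₂ ℝ (fun f (c : ℂ) => reSeries (c • f))
    (fun f g c => by rw [smul_add, map_add]) (fun a f c => by rw [smul_comm, map_smul])
    (fun f c c' => by rw [add_smul, map_add]) (fun a f c => by rw [smul_assoc, map_smul])

@[simp]
theorem reJet_tmul (f : MvPolynomial (Fin d) ℂ) (c : ℂ) (X : k) :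
    reJet d k f (c ⊗ₜ[ℝ] X) = reSeries (c • f) ⊗ₜ[ℝ] X := rfl

/-- Complex scalars pass between the factors, so an eigenvalue of `ad_{σ₀}` on `x` can be moved to
the polynomial. -/
theorem reJet_smul (a : ℂ) (f : MvPolynomial (Fin d) ℂ) (x : ℂ ⊗[ℝ] k) :
    reJet d k (a • f) x = reJet d k f (a • x) := by
  induction x using TensorProduct.induction_on with
  | zero => simp
  | tmul c X => rw [TensorProduct.smul_tmul', reJet_tmul, reJet_tmul, smul_smul, smul_eq_mul,
      mul_comm]
  | add x y hx hy => rw [smul_add, map_add, map_add, hx, hy]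

theorem jetCoeff_reJet (n : Fin d →₀ ℕ) (f : MvPolynomial (Fin d) ℂ) (x : ℂ ⊗[ℝ] k) :
    jetCoeff n (reJet d k f x) = rePart k (MvPolynomial.coeff n f • x) := by
  induction x using TensorProduct.induction_on with
  | zero => simp
  | tmul c X =>
    rw [TensorProduct.smul_tmul', rePart_tmul, reJet_tmul, jetCoeff_tmul, coeff_reSeries,
      MvPolynomial.coeff_smul, smul_eq_mul, smul_eq_mul, mul_comm]
  | add x y hx hy => rw [smul_add, map_add, map_add, map_add, hx, hy]

theorem reJet_mem_jetGr {N : ℕ} {f : MvPolynomial (Fin d) ℂ} (hf : f.IsHomogeneous N)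
    (x : ℂ ⊗[ℝ] k) : reJet d k f x ∈ jetGr d k N := by
  intro n hn
  rw [jetCoeff_reJet, hf.coeff_eq_zero hn, zero_smul, map_zero]

theorem lieDerivative_linearPart_reSeries (v : FormalVectorField d)
    (f : MvPolynomial (Fin d) ℂ) :
    v.linearPart.lieDerivative (reSeries f) = reSeries (linearDerivation v.complexMatrix f) := by
  classical
  ext n
  have h1 : v.linearPart.lieDerivative (reSeries f) =
      ∑ i, v.linearPart.comp i * MvPowerSeries.pderiv ℝ i (reSeries f) := by
    simp only [FormalVectorField.lieDerivative]
    rw [← Derivation.coeFnAddMonoidHom_apply, map_sum]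
    simp
  rw [h1, coeff_reSeries, linearDerivation_apply, MvPolynomial.coeff_sum, map_sum, Complex.re_sum]
  refine Finset.sum_congr rfl fun i _ => ?_
  rw [MvPowerSeries.coeff_mul, MvPolynomial.coeff_mul, Complex.re_sum]
  refine Finset.sum_congr rfl fun p _ => ?_
  have h2 : MvPolynomial.coeff p.1 (∑ j, v.complexMatrix i j • MvPolynomial.X j) =
      ((MvPowerSeries.coeff p.1 (v.linearPart.comp i) : ℝ) : ℂ) := by
    simp only [FormalVectorField.linearPart, MvPolynomial.coeff_sum, map_sum, Complex.ofReal_sum,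
      MvPolynomial.coeff_smul, MvPowerSeries.coeff_smul, MvPolynomial.coeff_X,
      MvPowerSeries.coeff_X, FormalVectorField.complexMatrix, Matrix.of_apply, smul_eq_mul]
    refine Finset.sum_congr rfl fun j _ => ?_
    by_cases h : p.1 = Finsupp.single j 1
    · simp [h]
    · simp [h, Ne.symm h]
  rw [h2, Complex.re_ofReal_mul, MvPowerSeries.coeff_pderiv, MvPolynomial.coeff_pderiv,
    coeff_reSeries]
  congr 1
  rw [← Nat.cast_add_one, ← Nat.cast_add_one, ← Complex.ofReal_natCast, mul_comm _ (Complex.ofReal _),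
    Complex.re_ofReal_mul, mul_comm]

theorem lieJet_linearPart_reJet (v : FormalVectorField d) (f : MvPolynomial (Fin d) ℂ)
    (x : ℂ ⊗[ℝ] k) :
    v.linearPart.lieJet k (reJet d k f x) = reJet d k (linearDerivation v.complexMatrix f) x := by
  induction x using TensorProduct.induction_on with
  | zero => simp
  | tmul c X =>
    rw [reJet_tmul, reJet_tmul, FormalVectorField.lieJet, LinearMap.rTensor_tmul,
      Derivation.coeFn_coe, lieDerivative_linearPart_reSeries, Derivation.map_smul]
  | add x y hx hy => rw [map_add, map_add, map_add, hx, hy]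

theorem bracket_constJet_reJet (X : k) (f : MvPolynomial (Fin d) ℂ) (x : ℂ ⊗[ℝ] k) :
    jetBracket (constJet d X) (reJet d k f x) =
      reJet d k f (LinearMap.baseChange ℂ (LieAlgebra.ad ℝ k X) x) := by
  induction x using TensorProduct.induction_on with
  | zero => simp
  | tmul c Y => simp [constJet]
  | add x y hx hy => rw [map_add, map_add, map_add, map_add, hx, hy]

/-- On an eigenvector `x` of `ad_X` the homological equation becomes the scalar equation for `L - c`
on polynomials. -/
theorem homologicalOperator_reJet (v : FormalVectorField d) (X : k) (f : MvPolynomial (Fin d) ℂ)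
    {x : ℂ ⊗[ℝ] k} {c : ℂ} (hx : LinearMap.baseChange ℂ (LieAlgebra.ad ℝ k X) x = c • x) :
    homologicalOperator v X (reJet d k f x) =
      reJet d k (linearDerivation v.complexMatrix f - c • f) x := by
  rw [homologicalOperator_apply, lieJet_linearPart_reJet, bracket_constJet_reJet, hx,
    ← reJet_smul, map_sub, LinearMap.sub_apply]

theorem mem_span_reJet [FiniteDimensional ℝ k] {N : ℕ} {ζ : JetAlgebra d k}
    (hζ : ζ ∈ jetGr d k N) :
    ζ ∈ Submodule.span ℝ {η | ∃ f : MvPolynomial (Fin d) ℂ, f.IsHomogeneous N ∧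
      ∃ x, η = reJet d k f x} := by
  classical
  have : ζ = ∑ n ∈ (Finsupp.finite_of_degree_eq (σ := Fin d) N).toFinset,
      reJet d k (MvPolynomial.monomial n 1) ((1 : ℂ) ⊗ₜ[ℝ] jetCoeff n ζ) := by
    refine jet_ext fun m => ?_
    rw [map_sum]
    simp only [jetCoeff_reJet, MvPolynomial.coeff_monomial]
    by_cases hm : m.degree = N
    · rw [Finset.sum_eq_single m]
      · simp
      · intro n _ hn
        simp [hn]
      · intro h
        exact absurd (by simp [hm]) h
    · rw [hζ m hm]
      refine (Finset.sum_eq_zero fun n hn => ?_).symm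
      have : n ≠ m := by
        rintro rfl
        exact hm (by simpa using hn)
      simp [this]
  rw [this]
  refine sum_mem fun n hn => Submodule.subset_span ⟨_, ?_, _, rfl⟩
  exact MvPolynomial.isHomogeneous_monomial _ (by simpa using hn)

/-- Solvability is additive in the right-hand side, and complex multiples of `x` are absorbed into
`f`, so a complex spanning set of `𝔨_ℂ` suffices. -/
theorem exists_homological_solution [FiniteDimensional ℝ k] (v : FormalVectorField d) (X : k)
    (S : Submodule ℝ (JetAlgebra d k)) {s : Set (ℂ ⊗[ℝ] k)} (hs : Submodule.span ℂ s = ⊤) {N : ℕ}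
    (h : ∀ x ∈ s, ∀ f : MvPolynomial (Fin d) ℂ, f.IsHomogeneous N → ∃ ξ ∈ jetGr d k N,
      reJet d k f x + homologicalOperator v X ξ ∈ S) {ζ : JetAlgebra d k}
    (hζ : ζ ∈ jetGr d k N) : ∃ ξ ∈ jetGr d k N, ζ + homologicalOperator v X ξ ∈ S := by
  have hadd : ∀ ζ ζ' : JetAlgebra d k,
      (∃ ξ ∈ jetGr d k N, ζ + homologicalOperator v X ξ ∈ S) →
      (∃ ξ ∈ jetGr d k N, ζ' + homologicalOperator v X ξ ∈ S) →
      ∃ ξ ∈ jetGr d k N, ζ + ζ' + homologicalOperator v X ξ ∈ S := by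
    rintro ζ ζ' ⟨ξ, hξ, h⟩ ⟨ξ', hξ', h'⟩
    refine ⟨ξ + ξ', add_mem hξ hξ', ?_⟩
    convert add_mem h h' using 1
    rw [map_add]
    abel
  have hzero : ∃ ξ ∈ jetGr d k N, (0 : JetAlgebra d k) + homologicalOperator v X ξ ∈ S :=
    ⟨0, zero_mem _, by rw [map_zero, add_zero]; exact zero_mem _⟩
  have key : ∀ x : ℂ ⊗[ℝ] k, ∀ f : MvPolynomial (Fin d) ℂ, f.IsHomogeneous N →
      ∃ ξ ∈ jetGr d k N, reJet d k f x + homologicalOperator v X ξ ∈ S := by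
    intro x
    have hx : x ∈ Submodule.span ℂ s := hs ▸ Submodule.mem_top
    induction hx using Submodule.span_induction with
    | mem x hx => exact h x hx
    | zero => intro f _; rw [map_zero]; exact hzero
    | add x y _ _ hx hy => intro f hf; rw [map_add]; exact hadd _ _ (hx f hf) (hy f hf)
    | smul a x _ hx =>
      intro f hf
      rw [← reJet_smul]
      exact hx _ ((MvPolynomial.homogeneousSubmodule (Fin d) ℂ N).smul_mem a hf)
  have hspan := mem_span_reJet hζ
  clear hζ
  induction hspan using Submodule.span_induction with
  | mem ζ h => obtain ⟨f, hf, x, rfl⟩ := h; exact key x f hf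
  | zero => exact hzero
  | add ζ ζ' _ _ h h' => exact hadd _ _ h h'
  | smul a ζ _ h =>
    obtain ⟨ξ, hξ, h⟩ := h
    refine ⟨a • ξ, Submodule.smul_mem _ _ hξ, ?_⟩
    convert S.smul_mem a h using 1
    rw [map_smul, smul_add]

/-- A linear projection of `𝔨` onto `𝔱`, tensored with `R`, lands in `R ⊗ 𝔱` and fixes `η`
coefficientwise. -/
theorem mem_jetSubspace [FiniteDimensional ℝ k] (t : LieSubalgebra ℝ k)
    {η : JetAlgebra d k} (h : ∀ n, jetCoeff n η ∈ t) : η ∈ jetSubspace d t := by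
  obtain ⟨g, hg⟩ := t.toSubmodule.subtype.exists_leftInverse_of_injective
    (LinearMap.ker_eq_bot.2 t.toSubmodule.injective_subtype)
  have hmem : ∀ η : JetAlgebra d k,
      LinearMap.lTensor (FormalSeries d) (t.toSubmodule.subtype ∘ₗ g) η ∈ jetSubspace d t := by
    intro η
    induction η using TensorProduct.induction_on with
    | zero => rw [map_zero]; exact zero_mem _
    | tmul f X => exact Submodule.tmul_mem_baseChange_of_mem f (g X).2
    | add x y hx hy => rw [map_add]; exact add_mem hx hy
  have hcoeff : ∀ (n : Fin d →₀ ℕ) (η : JetAlgebra d k),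
      jetCoeff n (LinearMap.lTensor (FormalSeries d) (t.toSubmodule.subtype ∘ₗ g) η) =
        t.toSubmodule.subtype (g (jetCoeff n η)) := by
    intro n η
    induction η using TensorProduct.induction_on with
    | zero => simp
    | tmul f X => simp
    | add x y hx hy => rw [map_add, map_add, hx, hy, map_add, map_add, map_add]
  have : LinearMap.lTensor (FormalSeries d) (t.toSubmodule.subtype ∘ₗ g) η = η := by
    refine jet_ext fun n => ?_
    rw [hcoeff]
    exact congrArg Subtype.val (LinearMap.congr_fun hg ⟨jetCoeff n η, h n⟩)
  rw [← this]
  exact hmem η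

/-! ### Normal forms: non-resonance and semisimple linearization. -/

variable {V : Type*} [AddCommGroup V] [Module ℝ V]

theorem exists_gaugeEquiv_mem_jetSubspace (b : Module.Basis (Fin d) ℝ V)
    (hk : IsCompactSimple k) (t : LieSubalgebra ℝ k) (ht : IsMaximalTorus t)
    (v : FormalVectorField d) (σ : JetAlgebra d k) (hσ : ev0 σ ∈ t) {μ : Fin d → ℂ}
    (hμ : IsEigenvalueFamily (v.linearization b) μ)
    (hres : ∀ α : t →ₗ[ℝ] ℂ, IsRoot t α → ∀ n : Fin d → ℕ, 1 ≤ ∑ i, n i →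
        ∑ i, (n i : ℂ) * μ i ≠ α ⟨ev0 σ, hσ⟩) :
    ∃ σ' ∈ jetSubspace d t, GaugeEquiv v σ σ' := by
  have := hk.finite
  let S : Submodule ℝ (JetAlgebra d k) :=
    ⨅ n : Fin d →₀ ℕ, t.toSubmodule.comap (jetCoeff n)
  have hS : ∀ {η : JetAlgebra d k}, η ∈ S ↔ ∀ n, jetCoeff n η ∈ t := by
    intro η
    simp only [S, Submodule.mem_iInf]
    rfl
  obtain ⟨ξ, -, η, y, z, hy, hz, hyz, -, h0, hη⟩ := exists_gauge_normal_form v σ S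
    fun N hN ζ hζ => exists_homological_solution v (ev0 σ) S (span_rootVectors_eq_top hk ht)
      (fun x hx f hf => by
        -- Root components are removed entirely, by non-resonance; components in `𝔱_ℂ` already have
        -- real part in `𝔱` and need no correction.
        rcases hx with ⟨α, hα, hx⟩ | ⟨c, H, hH, rfl⟩
        · obtain ⟨g, hg, hgf⟩ := exists_linearDerivation_sub_smul_eq b v hμ
            (fun n hn => hres α hα n (hn ▸ hN)) hf
          refine ⟨-reJet d k g x, neg_mem (reJet_mem_jetGr hg x), ?_⟩
          rw [map_neg, homologicalOperator_reJet v _ g (hx ⟨ev0 σ, hσ⟩), hgf, add_neg_cancel]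
          exact zero_mem _
        · refine ⟨0, zero_mem _, ?_⟩
          rw [map_zero, add_zero, hS]
          intro n
          rw [jetCoeff_reJet, TensorProduct.smul_tmul', rePart_tmul]
          exact t.smul_mem _ hH) hζ
  refine ⟨η, mem_jetSubspace t fun n => ?_, ξ, y, z, hy, hz, hyz⟩
  rcases Nat.eq_zero_or_pos n.degree with h | h
  · rw [(Finsupp.degree_eq_zero_iff n).1 h]
    change ev0 η ∈ t
    rwa [h0]
  · have := hS.1 (hη n.degree h) n
    rwa [jetCoeff_jetProj, if_pos rfl] at this

/-- The degree-zero component is the constant `X`, which `A` kills automatically; the components are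
then summed using that `A` preserves the filtration. -/
theorem homologicalOperator_eq_zero [FiniteDimensional ℝ k] {v : FormalVectorField d} {X : k}
    {η : JetAlgebra d k} (h0 : ev0 η = X)
    (hη : ∀ N, 1 ≤ N → homologicalOperator v X (jetProj d k N η) = 0) :
    homologicalOperator v X η = 0 := by
  have hproj : ∀ N, homologicalOperator v X (jetProj d k N η) = 0 := by
    intro N
    rcases Nat.eq_zero_or_pos N with rfl | h
    · have : jetProj d k 0 η = constJet d X := by
        refine jet_ext fun n => ?_
        rw [jetCoeff_jetProj]
        split_ifs with hn
        · rw [(Finsupp.degree_eq_zero_iff n).1 hn, jetCoeff_zero_constJet, ← h0]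
          rfl
        · rw [jetCoeff_constJet_of_ne]
          rintro rfl
          simp at hn
      rw [this, homologicalOperator_apply, lieJet_constJet, jetBracket_self, sub_zero]
    · exact hη N h
  have hsum : ∀ N, η - ∑ n ∈ Finset.range N, jetProj d k n η ∈ jetFil d k N := by
    intro N n hn
    rw [map_sub, map_sum, Finset.sum_eq_single n.degree, jetCoeff_jetProj, if_pos rfl, sub_self]
    · intro m _ hm
      rw [jetCoeff_jetProj, if_neg hm.symm]
    · intro h
      exact absurd (Finset.mem_range.2 hn) h
  refine eq_of_forall_sub_mem_jetFil fun N => ?_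
  have := homologicalOperator_mem_jetFil v X (hsum N)
  rwa [map_sub, map_sum, Finset.sum_eq_zero fun n _ => hproj n] at this

theorem exists_gaugeEquiv_homologicalOperator_eq_zero [FiniteDimensional ℝ k]
    (v : FormalVectorField d) (σ : JetAlgebra d k)
    (h : ∀ N, 1 ≤ N → ∀ ζ ∈ jetGr d k N, ∃ ξ ∈ jetGr d k N,
      ζ + homologicalOperator v (ev0 σ) ξ ∈ LinearMap.ker (homologicalOperator v (ev0 σ))) :
    ∃ ξ ∈ jetFil d k 1, ∃ η y z, IsExpAd ξ σ y ∧ IsFAd ξ (-(v.lieJet k ξ)) z ∧ η = y + z ∧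
      IsGaugeTransform v σ ξ η ∧ ev0 η = ev0 σ ∧ homologicalOperator v (ev0 σ) η = 0 := by
  obtain ⟨ξ, hξ, η, y, z, hy, hz, hyz, hη, h0, h1⟩ := exists_gauge_normal_form v σ _ h
  exact ⟨ξ, hξ, η, y, z, hy, hz, hyz, hη, h0, homologicalOperator_eq_zero h0 h1⟩

theorem exists_gaugeEquiv_of_isSemisimple (b : Module.Basis (Fin d) ℝ V)
    (hk : IsCompactSimple k) (v : FormalVectorField d) (σ : JetAlgebra d k)
    (hv : (v.linearization b).IsSemisimple) :
    ∃ ν : JetAlgebra d k, GaugeEquiv v σ ν ∧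
      -((linearVectorField b (v.linearization b)).lieJet k ν) + ⁅constJet d (ev0 σ), ν⁆ = 0 := by
  have := hk.finite
  obtain ⟨ξ, -, η, y, z, hy, hz, hyz, -, -, h⟩ :=
    exists_gaugeEquiv_homologicalOperator_eq_zero v σ fun N _ ζ hζ =>
      exists_homological_solution v (ev0 σ) _ (span_eigenvectors_ad_eq_top hk (ev0 σ))
        (fun x hx f hf => by
          obtain ⟨c, hx⟩ := hx
          obtain ⟨h, g, hg, hh, hf'⟩ := exists_add_linearDerivation_sub_smul_eq b v hv c hf
          refine ⟨-reJet d k g x, neg_mem (reJet_mem_jetGr hg x), ?_⟩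
          rw [map_neg, homologicalOperator_reJet v _ g hx, ← hf', map_add, LinearMap.add_apply,
            add_neg_cancel_right, LinearMap.mem_ker, homologicalOperator_reJet v _ h hx, hh,
            sub_self, map_zero, LinearMap.zero_apply]) hζ
  refine ⟨η, ⟨ξ, y, z, hy, hz, hyz⟩, ?_⟩
  rw [linearVectorField_linearization, lie_eq_jetBracket, ← neg_eq_zero, ← h,
    homologicalOperator_apply]
  abel

end ComplexJets

/-! ### Flows modulo powers of the maximal ideal. -/

section Flow

variable {d : ℕ} {k : Type*} [LieRing k] [LieAlgebra ℝ k]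

/-- A curve in `𝔤` has the given derivative modulo `I^M 𝔤`. -/
def HasJetDeriv (M : ℕ) (y : ℝ → JetAlgebra d k) (y' : JetAlgebra d k) (s : ℝ) : Prop :=
  ∀ l : Module.Dual ℝ (JetAlgebra d k), (∀ ξ ∈ jetFil d k M, l ξ = 0) →
    HasDerivAt (fun t => l (y t)) (l y') s

/-- Such a functional depends on finitely many coefficients only. This lets the generator property
of the circle action be tested by scalar derivatives. -/
theorem continuous_dual_of_jetFil [FiniteDimensional ℝ k] {M : ℕ}
    (l : Module.Dual ℝ (JetAlgebra d k)) (hl : ∀ ξ ∈ jetFil d k M, l ξ = 0) : Continuous l := by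
  classical
  have h : ∀ ξ, l ξ = ∑ n ∈ (Finsupp.finite_of_degree_lt (σ := Fin d) M).toFinset,
      (l ∘ₗ monoJet n) (jetCoeff n ξ) := by
    intro ξ
    rw [← sub_eq_zero]
    simp only [LinearMap.comp_apply]
    rw [← map_sum, ← map_sub]
    refine hl _ fun m hm => ?_
    rw [map_sub, map_sum, sub_eq_zero]
    simp only [jetCoeff_monoJet]
    rw [Finset.sum_ite_eq, if_pos (by simpa using hm)]
  rw [show ⇑l = _ from funext h]
  refine continuous_finsetSum _ fun n _ => ?_
  exact continuous_iInf_dom (i := n) (continuous_iInf_dom (i := l ∘ₗ monoJet n)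
    continuous_induced_dom)

theorem HasJetDeriv.congr {M : ℕ} {y : ℝ → JetAlgebra d k} {y₁ y₂ : JetAlgebra d k} {s : ℝ}
    (h : HasJetDeriv M y y₁ s) (h' : y₁ - y₂ ∈ jetFil d k M) : HasJetDeriv M y y₂ s := by
  intro l hl
  have : l y₂ = l y₁ := by rw [← sub_eq_zero, ← map_sub, ← neg_sub, map_neg, hl _ h', neg_zero]
  rw [this]
  exact h l hl

theorem HasJetDeriv.add {M : ℕ} {y z : ℝ → JetAlgebra d k} {y' z' : JetAlgebra d k} {s : ℝ}
    (hy : HasJetDeriv M y y' s) (hz : HasJetDeriv M z z' s) :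
    HasJetDeriv M (fun t => y t + z t) (y' + z') s := by
  intro l hl
  simp only [map_add]
  exact (hy l hl).add (hz l hl)

theorem HasJetDeriv.sub {M : ℕ} {y z : ℝ → JetAlgebra d k} {y' z' : JetAlgebra d k} {s : ℝ}
    (hy : HasJetDeriv M y y' s) (hz : HasJetDeriv M z z' s) :
    HasJetDeriv M (fun t => y t - z t) (y' - z') s := by
  intro l hl
  simp only [map_sub]
  exact (hy l hl).sub (hz l hl)

theorem HasJetDeriv.map {M N : ℕ} {y : ℝ → JetAlgebra d k} {y' : JetAlgebra d k} {s : ℝ}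
    (A : Module.End ℝ (JetAlgebra d k)) (hA : ∀ ξ ∈ jetFil d k M, A ξ ∈ jetFil d k N)
    (hy : HasJetDeriv M y y' s) : HasJetDeriv N (fun t => A (y t)) (A y') s :=
  fun l hl => hy (l ∘ₗ A) fun ξ hξ => hl _ (hA ξ hξ)

theorem HasJetDeriv.id_smul {M : ℕ} {y : ℝ → JetAlgebra d k} {y' : JetAlgebra d k} {s : ℝ}
    (hy : HasJetDeriv M y y' s) : HasJetDeriv M (fun t => t • y t) (y s + s • y') s := by
  intro l hl
  have := (hasDerivAt_id' s).mul (hy l hl)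
  rw [one_mul] at this
  simp only [map_add, map_smul, smul_eq_mul]
  exact this

theorem hasJetDeriv_const (M : ℕ) (ξ : JetAlgebra d k) (s : ℝ) :
    HasJetDeriv M (fun _ => ξ) 0 s := by
  intro l _
  simpa only [map_zero] using hasDerivAt_const s (l ξ)

instance finiteDimensional_quotient_jetFil [FiniteDimensional ℝ k] (M : ℕ) :
    FiniteDimensional ℝ (JetAlgebra d k ⧸ jetFil d k M) := by
  let s := {n : Fin d →₀ ℕ | n.degree < M}
  have : Finite s := Finsupp.finite_of_degree_lt (σ := Fin d) M
  let f : JetAlgebra d k →ₗ[ℝ] (s → k) := LinearMap.pi fun n => jetCoeff (n : Fin d →₀ ℕ)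
  have hf : LinearMap.ker f ≤ jetFil d k M := fun ξ hξ n hn =>
    congrFun (LinearMap.mem_ker.1 hξ) ⟨n, hn⟩
  have hf' : jetFil d k M ≤ LinearMap.ker f := fun ξ hξ =>
    LinearMap.mem_ker.2 (funext fun n => hξ n n.2)
  refine FiniteDimensional.of_injective ((jetFil d k M).liftQ f hf') ?_
  rw [← LinearMap.ker_eq_bot]
  exact Submodule.ker_liftQ_eq_bot _ _ hf' hf

/-- `D` descends to the finite-dimensional quotient by `I^M 𝔤`, where linear ODEs have unique
solutions. -/
theorem flow_unique [FiniteDimensional ℝ k] (D : Module.End ℝ (JetAlgebra d k)) {M : ℕ}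
    (hD : ∀ ξ ∈ jetFil d k M, D ξ ∈ jetFil d k M) {w : ℝ → JetAlgebra d k}
    (hw : ∀ t, HasJetDeriv M w (D (w t)) t) (h0 : w 0 ∈ jetFil d k M) (t : ℝ) :
    w t ∈ jetFil d k M := by
  let e := (Module.finBasis ℝ (JetAlgebra d k ⧸ jetFil d k M)).equivFun
  let π := e.toLinearMap ∘ₗ (jetFil d k M).mkQ
  have hπ : ∀ ξ, π ξ = 0 ↔ ξ ∈ jetFil d k M := fun ξ => by
    change e ((jetFil d k M).mkQ ξ) = 0 ↔ _
    rw [LinearEquiv.map_eq_zero_iff, Submodule.mkQ_apply, Submodule.Quotient.mk_eq_zero]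
  let B := e.toLinearMap ∘ₗ (jetFil d k M).mapQ (jetFil d k M) D hD ∘ₗ e.symm.toLinearMap
  have hB : ∀ ξ, π (D ξ) = B (π ξ) := fun ξ => by
    simp only [π, B, LinearMap.comp_apply, LinearEquiv.coe_coe, LinearEquiv.symm_apply_apply,
      Submodule.mkQ_apply, Submodule.mapQ_apply]
  have hderiv : ∀ t, HasDerivAt (fun t => π (w t)) (B (π (w t))) t := fun t => by
    rw [hasDerivAt_pi]
    intro i
    rw [← hB]
    refine hw t (LinearMap.proj i ∘ₗ π) fun ξ hξ => ?_
    rw [LinearMap.comp_apply, (hπ ξ).2 hξ, map_zero]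
  have h := ODE_solution_unique_univ (v := fun _ => B) (s := fun _ => Set.univ) (t₀ := 0)
    (f := fun t => π (w t)) (g := fun _ => 0)
    (fun _ => ((LinearMap.toContinuousLinearMap B).lipschitz).lipschitzOnWith)
    (fun t => ⟨hderiv t, Set.mem_univ _⟩)
    (fun t => ⟨by simpa using hasDerivAt_const t (0 : Fin _ → ℝ), Set.mem_univ _⟩)
    ((hπ _).2 h0)
  exact (hπ _).1 (congrFun h t)

theorem IntegratesToCircleAction.exists_flow [FiniteDimensional ℝ k] {T : ℝ}
    {D : Module.End ℝ (JetAlgebra d k)} (hT : IntegratesToCircleAction T D)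
    (X : JetAlgebra d k) : ∃ y : ℝ → JetAlgebra d k, y 0 = X ∧ y T = X ∧
      ∀ M t, HasJetDeriv M y (D (y t)) t := by
  obtain ⟨ρ, hρ⟩ := hT
  refine ⟨fun t => ρ.act (t : AddCircle T) X, ?_, ?_, fun M t l hl => ?_⟩
  · change ρ.act ((0 : ℝ) : AddCircle T) X = X
    rw [AddCircle.coe_zero, ρ.act_zero]
  · change ρ.act ((T : ℝ) : AddCircle T) X = X
    rw [AddCircle.coe_period, ρ.act_zero]
  -- By the group law, the difference quotient at time `t` is the one at time zero for the moved
  -- point.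
  · rw [hasDerivAt_iff_tendsto_slope_zero]
    refine (((continuous_dual_of_jetFil l hl).tendsto _).comp
      (hρ (ρ.act (t : AddCircle T) X))).congr fun s => ?_
    rw [Function.comp_apply, map_smul, map_sub, ← ρ.act_add, ← AddCircle.coe_add, add_comm s]

/-- A solution of `y' = D y` modulo `I^M 𝔤` is `T`-periodic modulo `I^M 𝔤`, if `D` generates an
action of `ℝ/Tℤ`. -/
theorem flow_periodic [FiniteDimensional ℝ k] {T : ℝ} {D : Module.End ℝ (JetAlgebra d k)}
    (hT : IntegratesToCircleAction T D) {M : ℕ}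
    (hD : ∀ ξ ∈ jetFil d k M, D ξ ∈ jetFil d k M) {y : ℝ → JetAlgebra d k}
    (hy : ∀ t, HasJetDeriv M y (D (y t)) t) : y T - y 0 ∈ jetFil d k M := by
  obtain ⟨z, hz0, hzT, hz⟩ := hT.exists_flow (y 0)
  have h := flow_unique D hD (w := fun t => y t - z t)
    (fun t => by rw [map_sub]; exact (hy t).sub (hz M t))
    (by rw [hz0, sub_self]; exact zero_mem _) T
  rwa [hzT] at h

end Flow

/-! ### Consequences of periodicity for the homological operator. -/

section Spectra

variable {d : ℕ} {k : Type*} [LieRing k] [LieAlgebra ℝ k]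

/-- A Jordan block at eigenvalue zero would give a solution growing linearly in time, which cannot
be periodic. -/
theorem homologicalOperator_eq_zero_of_sq [FiniteDimensional ℝ k] {v : FormalVectorField d}
    {σ : JetAlgebra d k} {T : ℝ} (hT0 : 0 < T)
    (hT : IntegratesToCircleAction T (twistedDerivative v σ)) {N : ℕ} {X : JetAlgebra d k}
    (hX : X ∈ jetGr d k N)
    (h : homologicalOperator v (ev0 σ) (homologicalOperator v (ev0 σ) X) = 0) :
    homologicalOperator v (ev0 σ) X = 0 := by
  set A := homologicalOperator v (ev0 σ) with hA
  have hAX : A X ∈ jetGr d k N := homologicalOperator_mem_jetGr _ _ hX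
  have h1 := flow_periodic hT (M := N + 1) (fun ξ hξ => twistedDerivative_mem_jetFil v σ hξ)
    -- This is `e^{-tA} X`, the exponential stopping because `A² X = 0`; modulo order `N + 1` it
    -- solves `y' = D y`.
    (y := fun t => X - t • A X) fun t => by
      refine ((hasJetDeriv_const (N + 1) X t).sub
        (hasJetDeriv_const (N + 1) (A X) t).id_smul).congr ?_
      have h2 := twistedDerivative_add_homologicalOperator_mem v σ (N := N)
        (ξ := X - t • A X) (jetGr_le_jetFil N (sub_mem hX (Submodule.smul_mem _ t hAX)))
      rw [← hA, map_sub A, map_smul A, h, smul_zero, sub_zero] at h2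
      convert neg_mem h2 using 1
      rw [smul_zero]
      abel
  refine eq_zero_of_mem_jetGr hAX ?_
  have h2 : T • A X ∈ jetFil d k (N + 1) := by
    convert neg_mem h1 using 1
    rw [zero_smul]
    abel
  exact (Submodule.smul_mem_iff _ hT0.ne').1 h2

instance finiteDimensional_jetGr [FiniteDimensional ℝ k] (N : ℕ) :
    FiniteDimensional ℝ (jetGr d k N) := by
  refine FiniteDimensional.of_injective ((jetFil d k (N + 1)).mkQ ∘ₗ (jetGr d k N).subtype) ?_
  intro ξ η h
  exact Subtype.ext (sub_eq_zero.1 (eq_zero_of_mem_jetGr (sub_mem ξ.2 η.2)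
    ((Submodule.Quotient.eq _).1 h)))

/-- `ker A² = ker A` makes range and kernel disjoint, hence complementary by rank-nullity. -/
theorem exists_map_add_map_eq_zero {W : Type*} [AddCommGroup W] [Module ℝ W]
    [FiniteDimensional ℝ W] (A : Module.End ℝ W) (hA : ∀ x, A (A x) = 0 → A x = 0) (z : W) :
    ∃ w, A (z + A w) = 0 := by
  have hdisj : Disjoint (LinearMap.range A) (LinearMap.ker A) := by
    rw [Submodule.disjoint_def]
    rintro _ ⟨x, rfl⟩ hx
    exact hA x hx
  have htop := Submodule.eq_top_of_disjoint _ _ (LinearMap.finrank_range_add_finrank_ker A).ge hdisj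
  obtain ⟨_, ⟨w, rfl⟩, y, hy, hsum⟩ := Submodule.mem_sup.1 (htop ▸ Submodule.mem_top :
    z ∈ LinearMap.range A ⊔ LinearMap.ker A)
  refine ⟨-w, ?_⟩
  rw [← hsum, map_neg, add_neg_cancel_comm]
  exact hy

theorem exists_homological_solution_of_circleAction [FiniteDimensional ℝ k]
    {v : FormalVectorField d} {σ : JetAlgebra d k} {T : ℝ} (hT0 : 0 < T)
    (hT : IntegratesToCircleAction T (twistedDerivative v σ)) {N : ℕ} {ζ : JetAlgebra d k}
    (hζ : ζ ∈ jetGr d k N) : ∃ ξ ∈ jetGr d k N,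
      ζ + homologicalOperator v (ev0 σ) ξ ∈ LinearMap.ker (homologicalOperator v (ev0 σ)) := by
  obtain ⟨w, hw⟩ := exists_map_add_map_eq_zero ((homologicalOperator v (ev0 σ)).restrict
    fun ξ (hξ : ξ ∈ jetGr d k N) => homologicalOperator_mem_jetGr v (ev0 σ) hξ)
    (fun X hX => Subtype.ext (homologicalOperator_eq_zero_of_sq hT0 hT X.2
      (congrArg Subtype.val hX))) ⟨ζ, hζ⟩
  exact ⟨w, w.2, congrArg Subtype.val hw⟩

/-- The real part of `e^{(c-a)t} f ⊗ x` solves `y' = D y` modulo order `N + 1`, so periodicity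
forces `e^{(c-a)T} = 1`. -/
theorem exists_int_of_eigenvectors [FiniteDimensional ℝ k] {v : FormalVectorField d}
    {σ : JetAlgebra d k} {T : ℝ} (hT0 : 0 < T)
    (hT : IntegratesToCircleAction T (twistedDerivative v σ)) {N : ℕ}
    {f : MvPolynomial (Fin d) ℂ} (hf : f.IsHomogeneous N) (hf0 : f ≠ 0) {a c : ℂ}
    (hfa : linearDerivation v.complexMatrix f = a • f) {x : ℂ ⊗[ℝ] k} (hx0 : x ≠ 0)
    (hx : LinearMap.baseChange ℂ (LieAlgebra.ad ℝ k (ev0 σ)) x = c • x) :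
    ∃ m : ℤ, c - a = 2 * Real.pi * Complex.I * m / T := by
  have key : ∀ f : MvPolynomial (Fin d) ℂ, f.IsHomogeneous N →
      linearDerivation v.complexMatrix f = a • f →
      reJet d k ((Complex.exp ((c - a) * T) - 1) • f) x = 0 := by
    intro f hf hfa
    have hsmul : ∀ z : ℂ, (z • f).IsHomogeneous N := fun z =>
      (MvPolynomial.homogeneousSubmodule (Fin d) ℂ N).smul_mem z hf
    have h1 := flow_periodic hT (M := N + 1) (fun ξ hξ => twistedDerivative_mem_jetFil v σ hξ)
      (y := fun t : ℝ => reJet d k (Complex.exp ((c - a) * t) • f) x) fun t => by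
        have hd : HasJetDeriv (N + 1)
            (fun t : ℝ => reJet d k (Complex.exp ((c - a) * t) • f) x)
            (reJet d k ((Complex.exp ((c - a) * t) * (c - a)) • f) x) t := by
          intro l _
          let g : ℂ →ₗ[ℝ] ℝ :=
            { toFun := fun z => l (reJet d k (z • f) x)
              map_add' := fun z z' => by rw [add_smul, map_add, LinearMap.add_apply, map_add]
              map_smul' := fun r z => by
                rw [smul_assoc, map_smul, LinearMap.smul_apply, map_smul, RingHom.id_apply] }
          have he : HasDerivAt (fun t : ℝ => Complex.exp ((c - a) * t))
              (Complex.exp ((c - a) * t) * (c - a)) t := by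
            have := ((Complex.ofRealCLM.hasDerivAt (x := t)).const_mul (c - a)).cexp
            simpa using this
          exact (LinearMap.toContinuousLinearMap g).hasFDerivAt.comp_hasDerivAt t he
        refine hd.congr ?_
        have h2 := twistedDerivative_add_homologicalOperator_mem v σ
          (jetGr_le_jetFil N (reJet_mem_jetGr (hsmul (Complex.exp ((c - a) * t))) x))
        rw [homologicalOperator_reJet v _ _ hx, Derivation.map_smul, hfa, smul_comm, ← sub_smul,
          ← neg_sub c a, neg_smul, map_neg, LinearMap.neg_apply, smul_smul,
          mul_comm (c - a) (Complex.exp _)] at h2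
        convert neg_mem h2 using 1
        abel
    refine eq_zero_of_mem_jetGr (reJet_mem_jetGr (hsmul _) x) ?_
    convert h1 using 1
    simp [sub_smul]
  have h1 := key f hf hfa
  -- Applying the same to `-i f` recovers the imaginary part, so the complex tensor itself vanishes.
  have h2 := key (-Complex.I • f)
    ((MvPolynomial.homogeneousSubmodule (Fin d) ℂ N).smul_mem _ hf)
    (by rw [Derivation.map_smul, hfa, smul_comm])
  obtain ⟨n, hn⟩ := MvPolynomial.ne_zero_iff.1 hf0
  have h3 := congrArg (jetCoeff n) h1
  have h4 := congrArg (jetCoeff n) h2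
  rw [smul_comm] at h4
  rw [jetCoeff_reJet, map_zero, MvPolynomial.coeff_smul] at h3 h4
  rw [MvPolynomial.coeff_smul, smul_eq_mul (-Complex.I), mul_smul] at h4
  have h5 := eq_zero_of_rePart_eq_zero h3 h4
  rw [smul_eq_mul, smul_eq_zero_iff_left hx0, mul_eq_zero, or_iff_left hn, sub_eq_zero,
    Complex.exp_eq_one_iff] at h5
  obtain ⟨m, hm⟩ := h5
  refine ⟨m, ?_⟩
  rw [eq_div_iff (by exact_mod_cast hT0.ne'), hm]
  ring

theorem exists_eigenvector_of_mem_complexSpectrum {W : Type*} [AddCommGroup W] [Module ℝ W]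
    [FiniteDimensional ℝ W] {A : Module.End ℝ W} {c : ℂ} (hc : c ∈ complexSpectrum A) :
    ∃ x : ℂ ⊗[ℝ] W, x ≠ 0 ∧ LinearMap.baseChange ℂ A x = c • x := by
  obtain ⟨x, hx⟩ := (Module.End.hasEigenvalue_iff_mem_spectrum.2 hc).exists_hasEigenvector
  exact ⟨x, hx.2, hx.apply_eq_smul⟩

/-- Linear functions on `V` are the degree-one polynomials, so spectral values of `v_l` must be
realized on the dual: take a functional killing the proper subspace `range (c - A)`. -/
theorem exists_dual_eigenvector_of_mem_complexSpectrum {W : Type*} [AddCommGroup W] [Module ℝ W]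
    [FiniteDimensional ℝ W] {A : Module.End ℝ W} {c : ℂ} (hc : c ∈ complexSpectrum A) :
    ∃ l : Module.Dual ℂ (ℂ ⊗[ℝ] W), l ≠ 0 ∧ l ∘ₗ LinearMap.baseChange ℂ A = c • l := by
  let B : Module.End ℂ (ℂ ⊗[ℝ] W) := algebraMap ℂ _ c - LinearMap.baseChange ℂ A
  have hB : LinearMap.range B < ⊤ := by
    rw [lt_top_iff_ne_top]
    intro h
    exact hc (LinearMap.isUnit_iff_range_eq_top B |>.2 h)
  obtain ⟨l, hl, hl'⟩ := Submodule.exists_le_ker_of_lt_top _ hB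
  refine ⟨l, hl, LinearMap.ext fun x => ?_⟩
  have := hl' ⟨x, rfl⟩
  simp only [B, LinearMap.mem_ker, LinearMap.sub_apply, map_sub, sub_eq_zero,
    Module.algebraMap_end_apply, map_smul] at this
  exact this.symm

/-- Neumann series: `∑ Eⁿ` converges because `E` raises the order. -/
theorem bijective_one_sub [FiniteDimensional ℝ k] (E : Module.End ℝ (JetAlgebra d k))
    (hE : ∀ N, ∀ ξ ∈ jetFil d k N, E ξ ∈ jetFil d k (N + 1)) :
    Function.Bijective (1 - E : Module.End ℝ (JetAlgebra d k)) := by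
  constructor
  · rw [← LinearMap.ker_eq_bot, LinearMap.ker_eq_bot']
    intro ξ hξ
    rw [LinearMap.sub_apply, Module.End.one_apply, sub_eq_zero] at hξ
    refine eq_of_forall_sub_mem_jetFil fun N => ?_
    rw [sub_zero]
    induction N with
    | zero => exact mem_jetFil_zero ξ
    | succ N ih => rw [hξ]; exact hE N ξ ih
  · intro z
    have hpow : ∀ n, (E ^ n) z ∈ jetFil d k n := fun n => by
      induction n with
      | zero => exact mem_jetFil_zero _
      | succ n ih => rw [pow_succ', Module.End.mul_apply]; exact hE n _ ih
    obtain ⟨y, -, hy⟩ := exists_hasSum_jet (fun n => (E ^ n) z) hpow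
    refine ⟨y, eq_of_forall_sub_mem_jetFil fun N => ?_⟩
    have h1 : (1 - E) (∑ n ∈ Finset.range N, (E ^ n) z) = z - (E ^ N) z := by
      have := LinearMap.congr_fun (mul_neg_geom_sum E N) z
      simpa only [Module.End.mul_apply, LinearMap.sum_apply, LinearMap.sub_apply,
        Module.End.one_apply] using this
    have h2 : (1 - E) (y - ∑ n ∈ Finset.range N, (E ^ n) z) ∈ jetFil d k N :=
      sub_mem (hy N) (jetFil_anti (Nat.le_succ N) (hE N _ (hy N)))
    rw [map_sub, h1] at h2
    convert sub_mem h2 (hpow N) using 1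
    abel

end Spectra

/-! ### The spectrum of `ad_σ` on the infinite-dimensional algebra `𝔤`. -/

section AdjointSpectrum

variable {W : Type*} [AddCommGroup W] [Module ℝ W]

/-- The real quadratic polynomial `(A - c)(A - c̄)` in an operator. -/
def quadraticIn (A : Module.End ℝ W) (c : ℂ) : Module.End ℝ W :=
  A * A - (2 * c.re) • A + Complex.normSq c • 1

theorem baseChange_quadraticIn (A : Module.End ℝ W) (c : ℂ) :
    LinearMap.baseChange ℂ (quadraticIn A c) =
      (algebraMap ℂ (Module.End ℂ (ℂ ⊗[ℝ] W)) c - LinearMap.baseChange ℂ A) *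
        (algebraMap ℂ (Module.End ℂ (ℂ ⊗[ℝ] W)) (starRingEnd ℂ c) - LinearMap.baseChange ℂ A) := by
  have h1 : algebraMap ℂ (Module.End ℂ (ℂ ⊗[ℝ] W)) c +
      algebraMap ℂ (Module.End ℂ (ℂ ⊗[ℝ] W)) (starRingEnd ℂ c) =
      algebraMap ℝ (Module.End ℂ (ℂ ⊗[ℝ] W)) (2 * c.re) := by
    rw [← map_add, Complex.add_conj]; rfl
  have h2 : algebraMap ℂ (Module.End ℂ (ℂ ⊗[ℝ] W)) c *
      algebraMap ℂ (Module.End ℂ (ℂ ⊗[ℝ] W)) (starRingEnd ℂ c) =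
      algebraMap ℝ (Module.End ℂ (ℂ ⊗[ℝ] W)) (Complex.normSq c) := by
    rw [← map_mul, Complex.mul_conj]; rfl
  change Module.End.baseChangeHom ℝ ℂ W (quadraticIn A c) =
    (_ - Module.End.baseChangeHom ℝ ℂ W A) * (_ - Module.End.baseChangeHom ℝ ℂ W A)
  rw [quadraticIn, map_add, map_sub, map_mul, map_smul, map_smul, map_one, Algebra.smul_def,
    Algebra.smul_def, ← h1, ← h2, mul_one, add_mul, sub_mul, mul_sub, mul_sub,
    
    Algebra.commutes (starRingEnd ℂ c) (Module.End.baseChangeHom ℝ ℂ W A)]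
  abel

theorem notMem_complexSpectrum_of_isUnit {A : Module.End ℝ W} {c : ℂ}
    (h : IsUnit (quadraticIn A c)) : c ∉ complexSpectrum A := by
  have h1 : IsUnit (LinearMap.baseChange ℂ (quadraticIn A c) : Module.End ℂ (ℂ ⊗[ℝ] W)) :=
    h.map (Module.End.baseChangeHom ℝ ℂ W)
  rw [baseChange_quadraticIn, Commute.isUnit_mul_iff] at h1
  · exact fun hc => hc h1.1
  · exact (Algebra.commute_algebraMap_left _ _).sub_left
      ((Algebra.commute_algebraMap_right _ _).sub_right (Commute.refl _))

theorem isUnit_of_notMem_complexSpectrum [FiniteDimensional ℝ W] {A : Module.End ℝ W} {c : ℂ}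
    (h : c ∉ complexSpectrum A) : IsUnit (quadraticIn A c) := by
  have h1 : IsUnit (algebraMap ℂ (Module.End ℂ (ℂ ⊗[ℝ] W)) c - LinearMap.baseChange ℂ A) :=
    not_not.1 h
  have hinj := ((Module.End.isUnit_iff _).1 h1).injective
  rw [LinearMap.isUnit_iff_ker_eq_bot, LinearMap.ker_eq_bot']
  intro x hx
  have h2 : LinearMap.baseChange ℂ (quadraticIn A c) ((1 : ℂ) ⊗ₜ[ℝ] x) = 0 := by
    rw [LinearMap.baseChange_tmul, hx, TensorProduct.tmul_zero]
  rw [baseChange_quadraticIn, Module.End.mul_apply] at h2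
  have h3 := (map_eq_zero_iff _ hinj).1 h2
  -- For real `c` the two factors coincide and injectivity applies again. Otherwise the imaginary
  -- part of `(c̄ - A)(1 ⊗ x) = 0` is a nonzero multiple of `x`.
  rcases eq_or_ne c.im 0 with him | him
  · rw [Complex.conj_eq_iff_im.2 him] at h3
    have h4 := congrArg (rePart W) ((map_eq_zero_iff _ hinj).1 h3)
    simpa using h4
  · have h4 := congrArg (imPart W) h3
    simpa [TensorProduct.smul_tmul', him] using h4

variable {d : ℕ} {k : Type*} [LieRing k] [LieAlgebra ℝ k]

theorem jetCoeff_lTensor (A : Module.End ℝ k) (n : Fin d →₀ ℕ) (ξ : JetAlgebra d k) :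
    jetCoeff n (LinearMap.lTensor (FormalSeries d) A ξ) = A (jetCoeff n ξ) := by
  induction ξ using TensorProduct.induction_on with
  | zero => simp
  | tmul f X => simp
  | add x y hx hy => rw [map_add, map_add, map_add, map_add, hx, hy]

theorem lTensor_mem_jetFil (A : Module.End ℝ k) {N : ℕ} {ξ : JetAlgebra d k}
    (hξ : ξ ∈ jetFil d k N) : LinearMap.lTensor (FormalSeries d) A ξ ∈ jetFil d k N := by
  intro n hn
  rw [jetCoeff_lTensor, hξ n hn, map_zero]

theorem quadraticIn_sub_lTensor_mem [FiniteDimensional ℝ k] (σ : JetAlgebra d k) (c : ℂ) {N : ℕ}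
    {ξ : JetAlgebra d k} (hξ : ξ ∈ jetFil d k N) :
    quadraticIn (jetBracket σ) c ξ -
      LinearMap.lTensor (FormalSeries d) (quadraticIn (LieAlgebra.ad ℝ k (ev0 σ)) c) ξ ∈
      jetFil d k (N + 1) := by
  let P := jetBracket (constJet d (ev0 σ))
  have hP : LinearMap.lTensor (FormalSeries d) (quadraticIn (LieAlgebra.ad ℝ k (ev0 σ)) c) ξ =
      quadraticIn P c ξ := by
    refine jet_ext fun n => ?_
    rw [jetCoeff_lTensor]
    simp [quadraticIn, P, jetCoeff_constJet_bracket]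
  have hE : ∀ η ∈ jetFil d k N, jetBracket σ η - P η ∈ jetFil d k (N + 1) := fun η hη => by
    have := bracket_mem_jetFil (sub_constJet_mem_jetFil_one σ) hη
    rwa [map_sub, LinearMap.sub_apply, add_comm 1] at this
  have h1 := hE _ (bracket_mem_jetFil_right σ hξ)
  have h2 := bracket_mem_jetFil_right (constJet d (ev0 σ)) (hE ξ hξ)
  have h3 := Submodule.smul_mem _ (2 * c.re) (hE ξ hξ)
  rw [hP]
  convert sub_mem (add_mem h1 h2) h3 using 1
  have h4 : (2 * c.re) • (jetBracket σ ξ - P ξ) =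
    (2 * c.re) • jetBracket σ ξ - (2 * c.re) • P ξ := smul_sub _ _ _
  rw [h4]
  simp only [quadraticIn, LinearMap.add_apply, LinearMap.sub_apply, Module.End.mul_apply,
    LinearMap.smul_apply, Module.End.one_apply]
  change _ = _ + P (jetBracket σ ξ - P ξ) - _
  rw [map_sub P]
  abel

theorem bijective_of_sub_mem [FiniteDimensional ℝ k] (Q : Module.End ℝ (JetAlgebra d k))
    (hQ : ∀ N, ∀ ξ ∈ jetFil d k N, ξ - Q ξ ∈ jetFil d k (N + 1)) : Function.Bijective Q := by
  have h := bijective_one_sub (1 - Q) hQ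
  convert h using 1
  exact funext fun ξ => (sub_sub_cancel ξ (Q ξ)).symm

/-- `ad_σ` differs from `ad_{σ₀}` by an operator raising the order, which cannot destroy
invertibility. The real quadratic `(ad - c)(ad - c̄)` lets this be argued on `𝔤` without
complexifying its filtration. -/
theorem complexSpectrum_adJet_subset [FiniteDimensional ℝ k] (σ : JetAlgebra d k) :
    complexSpectrum (adJet σ) ⊆ complexSpectrum (LieAlgebra.ad ℝ k (ev0 σ)) := by
  intro c hc
  by_contra hc'
  refine notMem_complexSpectrum_of_isUnit ?_ hc
  obtain ⟨u, hu⟩ := isUnit_of_notMem_complexSpectrum hc'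
  let C : Module.End ℝ (JetAlgebra d k) :=
    LinearMap.lTensor (FormalSeries d) ((u⁻¹ : (Module.End ℝ k)ˣ) : Module.End ℝ k)
  let Q : Module.End ℝ (JetAlgebra d k) := quadraticIn (jetBracket σ) c
  have hC : ∀ ξ, C (LinearMap.lTensor (FormalSeries d)
      (quadraticIn (LieAlgebra.ad ℝ k (ev0 σ)) c) ξ) = ξ := fun ξ => by
    rw [← hu, ← LinearMap.comp_apply, ← LinearMap.lTensor_comp, ← Module.End.mul_eq_comp,
      Units.inv_mul, Module.End.one_eq_id, LinearMap.lTensor_id, LinearMap.id_apply]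
  have hC' : ∀ ξ, LinearMap.lTensor (FormalSeries d)
      (quadraticIn (LieAlgebra.ad ℝ k (ev0 σ)) c) (C ξ) = ξ := fun ξ => by
    rw [← hu, ← LinearMap.comp_apply, ← LinearMap.lTensor_comp, ← Module.End.mul_eq_comp,
      Units.mul_inv, Module.End.one_eq_id, LinearMap.lTensor_id, LinearMap.id_apply]
  -- `C` inverts `Q` to leading order on both sides: `C * Q` gives injectivity of `Q`, and `Q * C`
  -- gives surjectivity.
  have h1 := bijective_of_sub_mem (C * Q) fun N ξ hξ => by
    have := neg_mem (lTensor_mem_jetFil ((u⁻¹ : (Module.End ℝ k)ˣ) : Module.End ℝ k)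
      (quadraticIn_sub_lTensor_mem σ c hξ))
    convert this using 1
    change ξ - C (Q ξ) = -C (Q ξ - _)
    rw [map_sub, hC, neg_sub]
  have h2 := bijective_of_sub_mem (Q * C) fun N ξ hξ => by
    have := neg_mem (quadraticIn_sub_lTensor_mem σ c (lTensor_mem_jetFil
      ((u⁻¹ : (Module.End ℝ k)ˣ) : Module.End ℝ k) hξ))
    convert this using 1
    change ξ - Q (C ξ) = -(Q (C ξ) - _)
    rw [hC', neg_sub]
  refine (Module.End.isUnit_iff _).2 ⟨fun x y hxy => h1.injective ?_, fun y => ?_⟩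
  · exact congrArg C hxy
  · obtain ⟨x, hx⟩ := h2.surjective y
    exact ⟨C x, hx⟩

end AdjointSpectrum

/-! ### Conjugating the twisted derivative by `e^{-ad_ξ}`. -/

section Intertwining

/-- The degree-`m` part of `q₀ e^{-a} = e^{-a} ∑ qₙ/n!`: right multiplication by `-a` is left
multiplication by `-a` plus the commutator with `a`, and these commute, so the binomial theorem
applies. -/
theorem mul_neg_pow_eq_sum {A : Type*} [Ring A] [Algebra ℝ A] (a : A) (q : ℕ → A)
    (hq : ∀ n, q (n + 1) = a * q n - q n * a) (m : ℕ) :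
    q 0 * ((m ! : ℝ)⁻¹ • (-a) ^ m) = ∑ p ∈ Finset.HasAntidiagonal.antidiagonal m,
      ((p.1 ! : ℝ)⁻¹ • (-a) ^ p.1) * ((p.2 ! : ℝ)⁻¹ • q p.2) := by
  let L : Module.End ℝ A := LinearMap.mulLeft ℝ a - LinearMap.mulRight ℝ a
  have hq' : ∀ n, q n = (L ^ n) (q 0) := fun n => by
    induction n with
    | zero => simp
    | succ n ih => rw [pow_succ', Module.End.mul_apply, ← ih, hq]; rfl
  have hcomm : Commute (LinearMap.mulLeft ℝ (-a)) L := by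
    refine Commute.sub_right ?_ (LinearMap.commute_mulLeft_right _ _)
    change _ * _ = _ * _
    ext x
    simp
  have h : LinearMap.mulRight ℝ (-a) = LinearMap.mulLeft ℝ (-a) + L := by
    ext x
    simp only [L, LinearMap.mulRight_apply, LinearMap.mulLeft_apply, LinearMap.add_apply,
      LinearMap.sub_apply, mul_neg, neg_mul]
    abel
  have h1 : q 0 * (-a) ^ m = (LinearMap.mulRight ℝ (-a) ^ m) (q 0) := by
    rw [LinearMap.pow_mulRight, LinearMap.mulRight_apply]
  rw [mul_smul_comm, h1, h, hcomm.add_pow', LinearMap.sum_apply, Finset.smul_sum]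
  refine Finset.sum_congr rfl fun p hp => ?_
  rw [← Finset.HasAntidiagonal.mem_antidiagonal.1 hp, LinearMap.smul_apply, Module.End.mul_apply,
    LinearMap.pow_mulLeft, LinearMap.mulLeft_apply, smul_mul_smul_comm, ← Nat.cast_smul_eq_nsmul ℝ,
    smul_smul, ← hq']
  congr 1
  have h2 := Nat.add_choose_mul_factorial_mul_factorial p.1 p.2
  rw [← Nat.choose_symm_add] at h2
  have h3 : ((p.1 + p.2).choose p.1 : ℝ) * p.1 ! * p.2 ! = (p.1 + p.2)! := by exact_mod_cast h2
  rw [← h3]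
  have : ((p.1 + p.2).choose p.1 : ℝ) ≠ 0 := by
    exact_mod_cast (Nat.choose_pos (Nat.le_add_right _ _)).ne'
  field_simp

variable {d : ℕ} {k : Type*} [LieRing k] [LieAlgebra ℝ k]

theorem twistedDerivative_bracket (v : FormalVectorField d) (σ ξ η : JetAlgebra d k) :
    twistedDerivative v σ (jetBracket ξ η) =
      jetBracket (twistedDerivative v σ ξ) η + jetBracket ξ (twistedDerivative v σ η) := by
  simp only [twistedDerivative_apply, lieJet_bracket, jetBracket_jacobi σ, map_add, map_neg,
    LinearMap.add_apply, LinearMap.neg_apply]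
  abel

/-- The iterated commutators of `ad_ξ` with the twisted derivative `-L_v + ad_σ`. -/
def iteratedCommutator (v : FormalVectorField d) (σ ξ : JetAlgebra d k) :
    ℕ → Module.End ℝ (JetAlgebra d k)
  | 0 => twistedDerivative v σ
  | n + 1 => -jetBracket ((jetBracket ξ ^ n) (twistedDerivative v σ ξ))

/-- As `D` is a derivation, `[ad_ξ, D] = -ad_{Dξ}`; further commutators follow from the Jacobi
identity. -/
theorem iteratedCommutator_succ (v : FormalVectorField d) (σ ξ : JetAlgebra d k) (n : ℕ) :
    iteratedCommutator v σ ξ (n + 1) =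
      (jetBracket ξ : Module.End ℝ (JetAlgebra d k)) * iteratedCommutator v σ ξ n -
        iteratedCommutator v σ ξ n * jetBracket ξ := by
  refine LinearMap.ext fun ζ => ?_
  change _ = jetBracket ξ (iteratedCommutator v σ ξ n ζ) -
    iteratedCommutator v σ ξ n (jetBracket ξ ζ)
  rcases n with _ | n
  · change -jetBracket (twistedDerivative v σ ξ) ζ = jetBracket ξ (twistedDerivative v σ ζ) -
      twistedDerivative v σ (jetBracket ξ ζ)
    rw [twistedDerivative_bracket]
    abel
  · change -jetBracket ((jetBracket ξ ^ (n + 1)) (twistedDerivative v σ ξ)) ζ =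
      jetBracket ξ (-jetBracket ((jetBracket ξ ^ n) (twistedDerivative v σ ξ)) ζ) -
        -jetBracket ((jetBracket ξ ^ n) (twistedDerivative v σ ξ)) (jetBracket ξ ζ)
    rw [map_neg, jetBracket_jacobi ξ _ ζ, pow_succ', Module.End.mul_apply]
    abel

/-- Isolates the error of multiplying truncated series: terms of total degree at least `m`, which
are negligible in the filtration. -/
theorem sum_antidiagonal_sub_mul_sum {A : Type*} [Ring A] (p q : ℕ → A) (m : ℕ) :
    (∑ i ∈ Finset.range m, p i) * (∑ n ∈ Finset.range m, q n) -
      ∑ j ∈ Finset.range m, ∑ x ∈ Finset.HasAntidiagonal.antidiagonal j, p x.1 * q x.2 =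
      ∑ x ∈ Finset.range m ×ˢ Finset.range m with ¬ x.1 + x.2 < m, p x.1 * q x.2 := by
  rw [Finset.sum_mul_sum, ← Finset.sum_product',
    ← Finset.sum_filter_add_sum_filter_not _ (fun x : ℕ × ℕ => x.1 + x.2 < m), sub_eq_iff_eq_add,
    add_comm]
  congr 1
  rw [← Finset.sum_fiberwise_of_maps_to (t := Finset.range m) (g := fun x : ℕ × ℕ => x.1 + x.2)
    (fun x hx => by simpa using (Finset.mem_filter.1 hx).2)]
  refine Finset.sum_congr rfl fun j hj => Finset.sum_congr ?_ fun _ _ => rfl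
  have := Finset.mem_range.1 hj
  ext x
  simp only [Finset.mem_filter, Finset.mem_product, Finset.mem_range,
    Finset.HasAntidiagonal.mem_antidiagonal]
  omega

/-- Modulo `I^M 𝔤`, the truncated exponential `e^{-ad_ξ}` intertwines the twisted derivative of the
gauge transform with that of `σ`. -/
theorem IsGaugeTransform.exists_intertwiner {v : FormalVectorField d} {σ ξ ν : JetAlgebra d k}
    (hξ : ξ ∈ jetFil d k 1) (h : IsGaugeTransform v σ ξ ν) (M : ℕ) :
    ∃ Φ : Module.End ℝ (JetAlgebra d k),
      (∀ N, ∀ ζ ∈ jetFil d k N, Φ ζ - ζ ∈ jetFil d k (N + 1)) ∧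
      ∀ ζ, twistedDerivative v σ (Φ ζ) - Φ (twistedDerivative v ν ζ) ∈ jetFil d k M := by
  let a : Module.End ℝ (JetAlgebra d k) := jetBracket ξ
  let D := twistedDerivative v σ
  let p : ℕ → Module.End ℝ (JetAlgebra d k) := fun i => (i ! : ℝ)⁻¹ • (-a) ^ i
  let q : ℕ → Module.End ℝ (JetAlgebra d k) := fun n =>
    (n ! : ℝ)⁻¹ • iteratedCommutator v σ ξ n
  have hp : ∀ i N, ∀ ζ ∈ jetFil d k N, p i ζ ∈ jetFil d k (i + N) := fun i N ζ hζ => by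
    refine Submodule.smul_mem _ _ ?_
    induction i with
    | zero => simpa using hζ
    | succ i ih =>
      rw [pow_succ', Module.End.mul_apply, add_right_comm, add_comm _ 1]
      exact neg_mem (bracket_mem_jetFil hξ ih)
  have hq : ∀ n ζ, q n ζ ∈ jetFil d k n := fun n ζ => by
    refine Submodule.smul_mem _ _ ?_
    rcases n with _ | n
    · exact mem_jetFil_zero _
    · exact neg_mem (bracket_mem_jetFil_left (bracket_pow_mem_jetFil hξ n
        (twistedDerivative_mem_jetFil v σ hξ)) ζ)
  let Φ := ∑ i ∈ Finset.range (M + 1), p i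
  have hΦ : ∀ N, ∀ ζ ∈ jetFil d k N, Φ ζ - ζ ∈ jetFil d k (N + 1) := by
    intro N ζ hζ
    have : Φ ζ - ζ = ∑ i ∈ Finset.range M, p (i + 1) ζ := by
      rw [LinearMap.sum_apply, Finset.sum_range_succ']
      simp [p]
    rw [this]
    exact sum_mem fun i _ => jetFil_anti (by omega) (hp (i + 1) N ζ hζ)
  have hΦ' : ∀ ζ ∈ jetFil d k M, Φ ζ ∈ jetFil d k M := fun ζ hζ => by
    have := add_mem (jetFil_anti (Nat.le_succ M) (hΦ M ζ hζ)) hζ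
    rwa [sub_add_cancel] at this
  refine ⟨Φ, hΦ, fun ζ => ?_⟩
  have h1 : D * Φ = ∑ j ∈ Finset.range (M + 1),
      ∑ x ∈ Finset.HasAntidiagonal.antidiagonal j, p x.1 * q x.2 := by
    rw [Finset.mul_sum]
    exact Finset.sum_congr rfl fun m _ => mul_neg_pow_eq_sum a _ (iteratedCommutator_succ v σ ξ) m
  have h2 := LinearMap.congr_fun (sum_antidiagonal_sub_mul_sum p q (M + 1)) ζ
  rw [← h1, LinearMap.sub_apply, LinearMap.sum_apply] at h2
  have h3 : Φ ((∑ n ∈ Finset.range (M + 1), q n) ζ) - D (Φ ζ) ∈ jetFil d k M := by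
    change _ = _ at h2
    have h4 : ∑ x ∈ Finset.range (M + 1) ×ˢ Finset.range (M + 1) with ¬ x.1 + x.2 < M + 1,
        (p x.1 * q x.2) ζ ∈ jetFil d k M := by
      refine sum_mem fun x hx => jetFil_anti ?_ (hp x.1 x.2 _ (hq x.2 ζ))
      have := (Finset.mem_filter.1 hx).2
      omega
    rw [← h2] at h4
    exact h4
  -- The sum of the `qₙ` is `D - ad` of the partial sum defining the gauge transform, hence `-L_v +
  -- ad_ν` modulo order `M`.
  have h5 : twistedDerivative v ν ζ - (∑ n ∈ Finset.range (M + 1), q n) ζ ∈ jetFil d k M := by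
    have h6 : (∑ n ∈ Finset.range (M + 1), q n) ζ = D ζ - jetBracket (∑ n ∈ Finset.range M,
        (((n + 1)! : ℕ) : ℝ)⁻¹ • (jetBracket ξ ^ n) (twistedDerivative v σ ξ)) ζ := by
      rw [Finset.sum_range_succ', LinearMap.add_apply, add_comm, sub_eq_add_neg, map_sum,
        LinearMap.sum_apply, LinearMap.sum_apply, ← Finset.sum_neg_distrib]
      congr 1
      · simp [q, D, iteratedCommutator]
      · refine Finset.sum_congr rfl fun n _ => ?_
        rw [map_smul, LinearMap.smul_apply]
        exact smul_neg _ _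
    rw [h6]
    convert bracket_mem_jetFil_left (h M) ζ using 1
    simp only [D, twistedDerivative_apply, map_sub, LinearMap.sub_apply]
    abel
  convert neg_mem (add_mem h3 (hΦ' _ h5)) using 1
  rw [map_sub]
  abel

end Intertwining

/-! ### Circle actions: rigidity of the normal form and integrality of the spectra. -/

section CircleRigidity

variable {d : ℕ} {k : Type*} [LieRing k] [LieAlgebra ℝ k]

theorem IsCompactSimple.eq_zero_of_bracket_eq_zero (hk : IsCompactSimple k) {Y : k}
    (h : ∀ X : k, ⁅Y, X⁆ = 0) : Y = 0 := by
  by_contra hY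
  have h1 : LieAlgebra.ad ℝ k Y = 0 := LinearMap.ext h
  have h2 := hk.negDef Y hY
  rw [killingForm_apply_apply, h1, LinearMap.zero_comp, map_zero] at h2
  exact lt_irrefl _ h2

theorem jetCoeff_bracket_constJet (n : Fin d →₀ ℕ) (X : k) (ξ : JetAlgebra d k) :
    jetCoeff n (jetBracket ξ (constJet d X)) = ⁅jetCoeff n ξ, X⁆ := by
  rw [← jetBracket_skew, map_neg, jetCoeff_constJet_bracket, lie_skew]

theorem homologicalOperator_constJet (v : FormalVectorField d) (X : k) :
    homologicalOperator v X (constJet d X) = 0 := by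
  rw [homologicalOperator_apply, lieJet_constJet, jetBracket_self, sub_self]

theorem homologicalOperator_bracket (v : FormalVectorField d) (X : k) (ξ η : JetAlgebra d k) :
    homologicalOperator v X (jetBracket ξ η) =
      jetBracket (homologicalOperator v X ξ) η + jetBracket ξ (homologicalOperator v X η) := by
  simp only [homologicalOperator_apply, lieJet_bracket, jetBracket_jacobi (constJet d X), map_sub,
    LinearMap.sub_apply]
  abel

/-- The constant terms of an integral curve of `-L_v + ad_σ` form an integral curve of
`-L_{v_l} + ad_{σ₀}`. -/
theorem HasJetDeriv.jetProj_zero [FiniteDimensional ℝ k] {v : FormalVectorField d}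
    {σ : JetAlgebra d k} {y : ℝ → JetAlgebra d k} {s : ℝ}
    (hy : HasJetDeriv 1 y (twistedDerivative v σ (y s)) s) (M : ℕ) :
    HasJetDeriv M (fun t => jetProj d k 0 (y t))
      (-homologicalOperator v (ev0 σ) (jetProj d k 0 (y s))) s := by
  have h0 : ∀ ξ ∈ jetFil d k 1, jetProj d k 0 ξ ∈ jetFil d k M := fun ξ hξ => by
    rw [jetProj_eq_of_sub_mem (η := 0) (by rwa [sub_zero]), map_zero]
    exact zero_mem _
  have h1 : jetProj d k 0 (twistedDerivative v σ (y s)) =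
      -homologicalOperator v (ev0 σ) (jetProj d k 0 (y s)) := by
    rw [← jetProj_of_mem (neg_mem (homologicalOperator_mem_jetGr v (ev0 σ)
      (jetProj_mem 0 (y s))))]
    refine jetProj_eq_of_sub_mem ?_
    convert sub_mem (twistedDerivative_add_homologicalOperator_mem v σ (mem_jetFil_zero (y s)))
      (homologicalOperator_mem_jetFil v (ev0 σ) (sub_jetProj_mem (mem_jetFil_zero (y s)))) using 1
    rw [map_sub]
    abel
  rw [← h1]
  exact hy.map _ h0

/-- Since `Ap = 0`, `ad_p` commutes with `A`, so the flow of `-A + ad_p` is that of `-A` times `e^{t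
ad_p}`. After one period the factor `-A` returns to `X`, leaving `T [p, X]`, which periodicity
forces to vanish to leading order. -/
theorem IsGaugeTransform.bracket_mem_jetFil_of_circleAction [FiniteDimensional ℝ k]
    {v : FormalVectorField d} {σ ξ ν : JetAlgebra d k}
    (hv : ∀ ζ : JetAlgebra d k, v.lieJet k ζ = v.linearPart.lieJet k ζ)
    (hξ : ξ ∈ jetFil d k 1) (hν : IsGaugeTransform v σ ξ ν)
    (h : homologicalOperator v (ev0 σ) ν = 0) {T : ℝ} (hT0 : 0 < T)
    (hT : IntegratesToCircleAction T (twistedDerivative v σ)) {N : ℕ} (hN : 1 ≤ N)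
    (hp : ν - constJet d (ev0 σ) ∈ jetFil d k N) (X : k) :
    jetBracket (ν - constJet d (ev0 σ)) (constJet d X) ∈ jetFil d k (N + 1) := by
  set p := ν - constJet d (ev0 σ) with hpdef
  set A := homologicalOperator v (ev0 σ) with hA
  have hAp : A p = 0 := by rw [hpdef, map_sub, h, hA, homologicalOperator_constJet, sub_zero]
  have hAP : ∀ ζ, A (jetBracket p ζ) = jetBracket p (A ζ) := fun ζ => by
    rw [hA, homologicalOperator_bracket, ← hA, hAp, map_zero, LinearMap.zero_apply, zero_add]
  have hDν : ∀ ζ, twistedDerivative v ν ζ = -A ζ + jetBracket p ζ := fun ζ => by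
    rw [twistedDerivative_apply, hA, homologicalOperator_apply, hv, hpdef, map_sub,
      LinearMap.sub_apply]
    abel
  obtain ⟨y, hy0, hyT, hy⟩ := hT.exists_flow (constJet d X)
  -- The constant term of the circle orbit of `X`: a `-A`-flow line that returns to `X` at time `T`.
  let z := fun t => jetProj d k 0 (y t)
  have hz : ∀ t, HasJetDeriv (N + 1) z (-A (z t)) t := fun t => (hy 1 t).jetProj_zero (N + 1)
  have hX : jetProj d k 0 (constJet d X) = constJet d X := jetProj_of_mem fun n hn =>
    jetCoeff_constJet_of_ne (fun hn0 => hn (by rw [hn0, map_zero])) X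
  have hz0 : z 0 = constJet d X := by simp only [z, hy0, hX]
  have hzT : z T = constJet d X := by simp only [z, hyT, hX]
  -- Because `2N ≥ N + 1`, `e^{t ad_p}` truncates to `1 + t ad_p`; this is where `N ≥ 1` enters.
  have hPP : ∀ ζ, jetBracket p (jetBracket p ζ) ∈ jetFil d k (N + 1) := fun ζ =>
    jetFil_anti (by omega) (bracket_mem_jetFil hp (bracket_mem_jetFil_left hp ζ))
  have hw : ∀ t, HasJetDeriv (N + 1) (fun t => z t + t • jetBracket p (z t))
      (twistedDerivative v ν (z t + t • jetBracket p (z t))) t := fun t => by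
    refine ((hz t).add ((hz t).map (jetBracket p)
      fun ζ hζ => bracket_mem_jetFil_right p hζ).id_smul).congr ?_
    convert neg_mem (Submodule.smul_mem _ t (hPP (z t))) using 1
    simp only [hDν, map_add, map_smul, hAP, map_neg]
    module
  obtain ⟨Φ, hΦ, hΦD⟩ := hν.exists_intertwiner hξ (N + 1)
  have hΦ' : ∀ ζ ∈ jetFil d k (N + 1), Φ ζ ∈ jetFil d k (N + 1) := fun ζ hζ => by
    have := add_mem (jetFil_anti (Nat.le_succ _) (hΦ _ ζ hζ)) hζ
    rwa [sub_add_cancel] at this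
  have h1 := flow_periodic hT (fun ζ hζ => twistedDerivative_mem_jetFil v σ hζ)
    (y := fun t => Φ (z t + t • jetBracket p (z t))) fun t => ((hw t).map Φ hΦ').congr (by
      rw [← neg_mem_iff, neg_sub]
      exact hΦD _)
  have h2 : Φ (jetBracket p (constJet d X)) ∈ jetFil d k (N + 1) := by
    refine (Submodule.smul_mem_iff _ hT0.ne').1 ?_
    convert h1 using 1
    simp only [hz0, hzT, zero_smul, add_zero]
    rw [← map_sub, add_sub_cancel_left, map_smul]
  -- `Φ` is the identity to leading order, so it can be dropped.
  have h3 := sub_mem h2 (hΦ N _ (bracket_mem_jetFil_left hp (constJet d X)))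
  rwa [sub_sub_cancel] at h3

/-- The leading coefficients of `ν - σ₀` are central in `𝔨`, and a central element has zero Killing
form; induct on the order. -/
theorem IsGaugeTransform.eq_constJet_of_circleAction (hk : IsCompactSimple k)
    {v : FormalVectorField d} {σ ξ ν : JetAlgebra d k}
    (hv : ∀ ζ : JetAlgebra d k, v.lieJet k ζ = v.linearPart.lieJet k ζ)
    (hξ : ξ ∈ jetFil d k 1) (hν : IsGaugeTransform v σ ξ ν) (h0 : ev0 ν = ev0 σ)
    (h : homologicalOperator v (ev0 σ) ν = 0) {T : ℝ} (hT0 : 0 < T)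
    (hT : IntegratesToCircleAction T (twistedDerivative v σ)) : ν = constJet d (ev0 σ) := by
  have := hk.finite
  have key : ∀ N, ν - constJet d (ev0 σ) ∈ jetFil d k (N + 1) := fun N => by
    induction N with
    | zero => exact h0 ▸ sub_constJet_mem_jetFil_one ν
    | succ N ih =>
      intro n hn
      refine hk.eq_zero_of_bracket_eq_zero fun X => ?_
      rw [← jetCoeff_bracket_constJet]
      exact hν.bracket_mem_jetFil_of_circleAction hv hξ h hT0 hT (Nat.le_add_left 1 N) ih X n hn
  exact eq_of_forall_sub_mem_jetFil fun N => jetFil_anti (Nat.le_succ N) (key N)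

theorem gaugeEquiv_constJet_of_circleAction (hk : IsCompactSimple k) {v : FormalVectorField d}
    (hv : v = v.linearPart) {σ : JetAlgebra d k} {T : ℝ} (hT0 : 0 < T)
    (hT : IntegratesToCircleAction T (twistedDerivative v σ)) :
    GaugeEquiv v σ (constJet d (ev0 σ)) := by
  have := hk.finite
  obtain ⟨ξ, hξ, η, y, z, hy, hz, hyz, hη, h0, h1⟩ :=
    exists_gaugeEquiv_homologicalOperator_eq_zero v σ fun N _ ζ hζ =>
      exists_homological_solution_of_circleAction hT0 hT hζ
  refine ⟨ξ, y, z, hy, hz, ?_⟩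
  rw [← hyz]
  exact (hη.eq_constJet_of_circleAction hk (fun ζ => by rw [← hv]) hξ h0 h1 hT0 hT).symm

/-- Supplies an eigenvector of `ad_{σ₀}` with eigenvalue zero, so that the spectrum of `v_l` can be
seen alone. -/
theorem IsCompactSimple.exists_ne_zero_bracket_eq_zero (hk : IsCompactSimple k) (Y : k) :
    ∃ X : k, X ≠ 0 ∧ ⁅Y, X⁆ = 0 := by
  by_cases hY : Y = 0
  · have := hk.simple
    have : Nontrivial k := not_subsingleton_iff_nontrivial.1 fun _ =>
      LieAlgebra.IsSimple.non_abelian ℝ (L := k) ⟨fun _ _ => Subsingleton.elim _ _⟩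
    obtain ⟨X, hX⟩ := exists_ne (0 : k)
    exact ⟨X, hX, by rw [hY, zero_lie]⟩
  · exact ⟨Y, hY, lie_self Y⟩

theorem complexSpectrum_linearization_subset_of_circleAction {V : Type*} [AddCommGroup V]
    [Module ℝ V] (b : Module.Basis (Fin d) ℝ V) (hk : IsCompactSimple k)
    {v : FormalVectorField d} {σ : JetAlgebra d k} {T : ℝ} (hT0 : 0 < T)
    (hT : IntegratesToCircleAction T (twistedDerivative v σ)) :
    complexSpectrum (v.linearization b) ⊆
      {z : ℂ | ∃ m : ℤ, z = 2 * Real.pi * Complex.I * m / T} := by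
  have := hk.finite
  have := Module.Basis.finiteDimensional_of_finite b
  intro c hc
  obtain ⟨l, hl0, hl⟩ := exists_dual_eigenvector_of_mem_complexSpectrum hc
  obtain ⟨X, hX0, hX⟩ := hk.exists_ne_zero_bracket_eq_zero (ev0 σ)
  obtain ⟨m, hm⟩ := exists_int_of_eigenvectors hT0 hT (linearForm_isHomogeneous b l)
    ((map_ne_zero_iff _ (linearForm_injective b)).2 hl0)
    (by rw [linearDerivation_linearForm, hl, map_smul]) (x := (1 : ℂ) ⊗ₜ[ℝ] X) (c := 0)
    (fun h => hX0 (by simpa using congrArg (rePart k) h))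
    (by rw [LinearMap.baseChange_tmul, LieAlgebra.ad_apply, hX, TensorProduct.tmul_zero, zero_smul])
  refine ⟨-m, ?_⟩
  rw [← neg_neg c, ← zero_sub c, hm]
  push_cast
  ring

theorem complexSpectrum_ad_subset_of_circleAction [FiniteDimensional ℝ k]
    {v : FormalVectorField d} {σ : JetAlgebra d k} {T : ℝ} (hT0 : 0 < T)
    (hT : IntegratesToCircleAction T (twistedDerivative v σ)) :
    complexSpectrum (LieAlgebra.ad ℝ k (ev0 σ)) ⊆
      {z : ℂ | ∃ m : ℤ, z = 2 * Real.pi * Complex.I * m / T} := by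
  intro c hc
  obtain ⟨x, hx0, hx⟩ := exists_eigenvector_of_mem_complexSpectrum hc
  obtain ⟨m, hm⟩ := exists_int_of_eigenvectors hT0 hT (MvPolynomial.isHomogeneous_one _ _)
    one_ne_zero (a := 0) (by rw [Derivation.map_one_eq_zero, zero_smul]) hx0 hx
  exact ⟨m, by rw [← hm, sub_zero]⟩

end CircleRigidity

end JetTwist

end

theorem mainTheorem8 {d : ℕ} {V : Type*} [AddCommGroup V] [Module ℝ V]
    (b : Module.Basis (Fin d) ℝ V)
    {k : Type*} [LieRing k] [LieAlgebra ℝ k] (hk : IsCompactSimple k)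
    (t : LieSubalgebra ℝ k) (ht : IsMaximalTorus t)
    (v : FormalVectorField d) (σ : JetAlgebra d k) (hσ : ev0 σ ∈ t) :
    -- (1) non-resonance
    (∀ μ : Fin d → ℂ, IsEigenvalueFamily (v.linearization b) μ →
      (∀ α : t →ₗ[ℝ] ℂ, IsRoot t α → ∀ n : Fin d → ℕ, 1 ≤ ∑ i, n i →
        ∑ i, (n i : ℂ) * μ i ≠ α ⟨ev0 σ, hσ⟩) →
      ∃ σ' ∈ jetSubspace d t, GaugeEquiv v σ σ') ∧
    -- (2) semisimple linearization
    ((v.linearization b).IsSemisimple →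
      ∃ ν : JetAlgebra d k, GaugeEquiv v σ ν ∧
        -((linearVectorField b (v.linearization b)).lieJet k ν) + ⁅constJet d (ev0 σ), ν⁆ = 0) ∧
    -- (3) circle actions
    (v = linearVectorField b (v.linearization b) →
      ∀ T : ℝ, 0 < T → IntegratesToCircleAction T (-(v.lieJet k) + adJet σ) →
        GaugeEquiv v σ (constJet d (ev0 σ)) ∧
        complexSpectrum (v.linearization b) ∪ complexSpectrum (adJet σ) ∪
            complexSpectrum (LieAlgebra.ad ℝ k (ev0 σ)) ⊆
          {z : ℂ | ∃ m : ℤ, z = 2 * Real.pi * Complex.I * m / T}) := by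
  have := hk.finite
  refine ⟨fun μ hμ hres => exists_gaugeEquiv_mem_jetSubspace b hk t ht v σ hσ hμ hres,
    fun hv => exists_gaugeEquiv_of_isSemisimple b hk v σ hv, fun hlin T hT0 hT => ?_⟩
  have hT' : IntegratesToCircleAction T (twistedDerivative v σ) := hT
  have had := complexSpectrum_ad_subset_of_circleAction hT0 hT'
  exact ⟨gaugeEquiv_constJet_of_circleAction hk
      (hlin.trans (linearVectorField_linearization b v)) hT0 hT',
    Set.union_subset (Set.union_subset
      (complexSpectrum_linearization_subset_of_circleAction b hk hT0 hT')
      ((complexSpectrum_adJet_subset σ).trans had)) had⟩
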